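/- **Setting.** Let $\mathcal X\subseteq\mathbb R^d$, let $\mathcal S\subseteq\mathcal X$ be compact and non-empty, and let $k$ be a continuous positive-definite kernel on $\mathcal X$ with $k(x,x)\le 1$ and reproducing kernel Hilbert space $\mathcal H_k$. Let $f\in\mathcal H_k$ with $\|f\|_k\le B$. Each target $x\in\mathcal S$ has a query distribution $P^q_x$, a probability measure on $\mathcal X$ (depending measurably on $x$). For every $x\in\mathcal S$, if $\tilde x\sim P^q_x$, then $f(\tilde x)-\mathbb E[f(\tilde x)]$ is $\sigma_q$-sub-Gaussian, $\sigma_q>0$ (a random variable $Y$ is $\sigma$-sub-Gaussian if $\mathbb E[e^{sY}]\le e^{s^2\sigma^2/2}$ for all $s\in\mathbb R$). In round $t=1,2,\dots$ (up to a finite or infinite horizon $N$) a target $x_t\in\mathcal S$ is chosen, measurably with respect to the past $\mathcal F_{t-1}$, where $(\mathcal F_t)$ is a filtration such that $y_t$ is $\mathcal F_t$-measurable. The query is executed at a location $\tilde x_t$ whose conditional law given $\mathcal F_{t-1}$ is $P^q_{x_t}$, and $y_t=f(\tilde x_t)+\zeta_t$ is observed. The noise $\zeta_t$ is $\sigma_\zeta$-sub-Gaussian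 conditionally on $\mathcal F_{t-1}$ and $\tilde x_t$ ($\sigma_\zeta\ge 0$); this holds in particular if $\zeta_t$ is $\sigma_\zeta$-sub-Gaussian given $\mathcal F_{t-1}$ and independent of $\tilde x_t$ given $\mathcal F_{t-1}$. On probability measures on $\mathcal X$ put $\tilde k(P,P')=\iint k(z,z')\,dP(z)\,dP'(z')$. For a parameter $\lambda>0$ and measures $P_1,\dots,P_n$ with values $y=(y_1,\dots,y_n)^{\mathsf T}$ let $\tilde K_n=[\tilde k(P_i,P_j)]_{ij}$, $\tilde k_n(P)=[\tilde k(P,P_i)]_i$, and $$\tilde\mu_n(P)=\tilde k_n(P)^{\mathsf T}(\tilde K_n+\lambda I)^{-1}y,\qquad \tilde\sigma_n^2(P)=\tilde k(P,P)-\tilde k_n(P)^{\mathsf T}(\tilde K_n+\lambda I)^{-1}\tilde k_n(P),$$ $$\tilde I_n(P_1,\dots,P_n)=\tfrac12\log\det(I+\lambda^{-1}\tilde K_n),\qquad \tilde\gamma^q_n=\sup\{\tilde I_n(P_1,\dots,P_n): P_1,\dots,P_n\in\{P^q_x:x\in\mathcal S\}\},$$ where repetitions are allowed in the supremum. Let $\delta\in(0,1)$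 and $\sigma_\nu=\sqrt{\sigma_q^2+\sigma_\zeta^2}$. The algorithm uGP-UCB, with the true query distributions as its model, selects (almost surely) $$x_t\in\operatorname*{argmax}_{x\in\mathcal S}\ \tilde\mu_{t-1}(P^q_x)+\beta_t\,\tilde\sigma_{t-1}(P^q_x),\qquad \beta_t=B+\sigma_\nu\sqrt{2\big(\tilde I_{t-1}(P^q_{x_1},\dots,P^q_{x_{t-1}})+1+\log(1/\delta)\big)},$$ where $\tilde\mu_{t-1},\tilde\sigma_{t-1}$ are computed from the data $(P^q_{x_i},y_i)_{i<t}$. **Theorem.** For every $\sigma_q>0$, $\sigma_\zeta\ge0$ and $\Lambda\ge 1$ there is a constant $C>0$, depending only on $\sigma_q,\sigma_\zeta,\Lambda$, such that in the above setting, for every $\lambda\in[1,\Lambda]$, with probability at least $1-\delta$ the uncertain-inputs cumulative regret $$R_n=\sum_{t=1}^n\Big(\sup_{x\in\mathcal S}\mathbb E_{P^q_x}[f]-\mathbb E_{P^q_{x_t}}[f]\Big)$$ satisfies, simultaneously for all $n\le N$ (all finite $n$ if $N=\infty$), $$R_n\le C\,\sqrt{n\,\tilde\gamma^q_n}\,\Big(B+\sqrt{\tilde\gamma^q_n+\log(1/\delta)}\Big).$$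 -/

import Mathlib

open MeasureTheory ProbabilityTheory
open scoped NNReal ENNReal Matrix

noncomputable section

namespace UGP

/-! ### Gaussian process regression with an arbitrary input set -/

section GP

variable {ι : Type*}

/-- Gram matrix `[k(Pᵢ, Pⱼ)]ᵢⱼ`. -/
def gram (k : ι → ι → ℝ) {n : ℕ} (P : Fin n → ι) : Matrix (Fin n) (Fin n) ℝ :=
  Matrix.of fun i j => k (P i) (P j)

/-- The vector `[k(Q, P₁), …, k(Q, Pₙ)]`. -/
def kvec (k : ι → ι → ℝ) {n : ℕ} (P : Fin n → ι) (Q : ι) : Fin n → ℝ :=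
  fun i => k Q (P i)

/-- Posterior mean `kₙ(Q)ᵀ (Kₙ + lam I)⁻¹ yₙ`. -/
def postMean (k : ι → ι → ℝ) (lam : ℝ) {n : ℕ} (P : Fin n → ι) (y : Fin n → ℝ) (Q : ι) : ℝ :=
  kvec k P Q ⬝ᵥ ((gram k P + lam • (1 : Matrix (Fin n) (Fin n) ℝ))⁻¹ *ᵥ y)

/-- Posterior covariance `k(Q, Q') - kₙ(Q)ᵀ (Kₙ + lam I)⁻¹ kₙ(Q')`. -/
def postCov (k : ι → ι → ℝ) (lam : ℝ) {n : ℕ} (P : Fin n → ι) (Q Q' : ι) : ℝ :=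
  k Q Q' - kvec k P Q ⬝ᵥ ((gram k P + lam • (1 : Matrix (Fin n) (Fin n) ℝ))⁻¹ *ᵥ kvec k P Q')

/-- Posterior standard deviation. -/
def postStd (k : ι → ι → ℝ) (lam : ℝ) {n : ℕ} (P : Fin n → ι) (Q : ι) : ℝ :=
  √(postCov k lam P Q Q)

/-- Information gain `½ log det (I + lam⁻¹ Kₙ)` of the observations at `P₁, …, Pₙ`. -/
def infoGain (k : ι → ι → ℝ) (lam : ℝ) {n : ℕ} (P : Fin n → ι) : ℝ :=
  1 / 2 * Real.log (1 + lam⁻¹ • gram k P).det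

/-- Maximum information gain: the supremum of the information gain of `n` inputs (repetitions
allowed) taken from the set `A`. -/
def maxInfoGain (k : ι → ι → ℝ) (lam : ℝ) (A : Set ι) (n : ℕ) : ℝ :=
  ⨆ P : Fin n → A, infoGain k lam (fun i => (P i : ι))

end GP

/-! ### Kernels on points and on distributions -/

/-- `k` is the reproducing kernel of the Hilbert space `H` of real functions on `X`. -/
def IsReproducingKernel {X : Type*} (H : Type*) [NormedAddCommGroup H] [InnerProductSpace ℝ H]
    [CompleteSpace H] [RKHS ℝ H X ℝ] (k : X → X → ℝ) : Prop :=
  ∀ x y, RKHS.kernel H x y 1 = k x y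

/-- The kernel `k̃(P, P') = ∫∫ k(z, z') dP(z) dP'(z')` on probability measures. -/
def distKernel {X : Type*} [MeasurableSpace X] (k : X → X → ℝ) (P P' : ProbabilityMeasure X) : ℝ :=
  ∫ z', ∫ z, k z z' ∂(P : Measure X) ∂(P' : Measure X)

/-- The query distribution of the target `x`, as an element of the space of probability
measures. -/
def queryDist {S X : Type*} [MeasurableSpace S] [MeasurableSpace X] (q : Kernel S X)
    [IsMarkovKernel q] (x : S) : ProbabilityMeasure X :=
  ⟨q x, inferInstance⟩

/-! ### The query process -/

/-- `Y` is `σ`-sub-Gaussian conditionally on the σ-algebra `m`; exponential moments are required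
to be finite, so that the conditional expectations are meaningful. -/
def CondSubGaussian {Ω : Type*} (m : MeasurableSpace Ω) [MeasurableSpace Ω] (Y : Ω → ℝ) (σ : ℝ≥0)
    (μ : Measure Ω) : Prop :=
  ∀ s : ℝ, Integrable (fun ω => Real.exp (s * Y ω)) μ ∧
    μ[fun ω => Real.exp (s * Y ω) | m] ≤ᵐ[μ] fun _ => Real.exp (s ^ 2 * (σ : ℝ) ^ 2 / 2)

/-- The observation `y = f(x̃) + ζ` (rounds are numbered from `0`). -/
def obs {Ω X : Type*} (f : X → ℝ) (xq : ℕ → Ω → X) (ζ : ℕ → Ω → ℝ) (i : ℕ) (ω : Ω) : ℝ :=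
  f (xq i ω) + ζ i ω

/-- A sequential query process over `N` rounds (`N = ⊤` for infinitely many), rounds being
numbered from `0`: `x i` is the target, `xq i` the location at which the query is executed,
`ζ i` the observation noise, and `ℱ i` is the information available before round `i`. -/
structure IsQueryProcess {Ω S X : Type*} [mΩ : MeasurableSpace Ω] [MeasurableSpace S]
    [mX : MeasurableSpace X] (μ : Measure Ω) (ℱ : Filtration ℕ mΩ) (N : ℕ∞) (q : Kernel S X)
    (f : X → ℝ) (σζ : ℝ≥0) (x : ℕ → Ω → S) (xq : ℕ → Ω → X) (ζ : ℕ → Ω → ℝ) : Prop where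
  /-- the target is chosen from the past -/
  target_measurable : ∀ i : ℕ, (i : ℕ∞) < N → Measurable[ℱ i] (x i)
  query_measurable : ∀ i : ℕ, (i : ℕ∞) < N → Measurable (xq i)
  noise_measurable : ∀ i : ℕ, (i : ℕ∞) < N → Measurable (ζ i)
  /-- the observation is known after the round -/
  obs_measurable : ∀ i : ℕ, (i : ℕ∞) < N → Measurable[ℱ (i + 1)] (obs f xq ζ i)
  /-- given the past, the executed query has the query distribution of the target -/
  query_law : ∀ i : ℕ, (i : ℕ∞) < N → ∀ A : Set X, MeasurableSet A →
    μ[(xq i ⁻¹' A).indicator (fun _ => (1 : ℝ)) | ℱ i] =ᵐ[μ] fun ω => (q (x i ω)).real A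
  /-- the noise is sub-Gaussian given the past and the executed query location -/
  noise_subGaussian : ∀ i : ℕ, (i : ℕ∞) < N →
    CondSubGaussian (ℱ i ⊔ MeasurableSpace.comap (xq i) mX) (ζ i) σζ μ

/-! ### The algorithm -/

section Algorithm

variable {S X : Type*} [MeasurableSpace S] [MeasurableSpace X]

/-- The parameter `B + σν √(2 (I + 1 + log (1/δ)))`, where `I` is the information gain of the
data collected so far. -/
def beta (B σν δ gain : ℝ) : ℝ :=
  B + σν * √(2 * (gain + 1 + Real.log (1 / δ)))

/-- The upper confidence bound acquisition function at the target `z`, when the targets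
`x₁, …, xᵢ` with observations `y₁, …, yᵢ` have been tried. -/
def acquisition (k : X → X → ℝ) (q : Kernel S X) [IsMarkovKernel q] (lam B σν δ : ℝ) {i : ℕ}
    (x : Fin i → S) (y : Fin i → ℝ) (z : S) : ℝ :=
  postMean (distKernel k) lam (fun j => queryDist q (x j)) y (queryDist q z) +
    beta B σν δ (infoGain (distKernel k) lam (fun j => queryDist q (x j))) *
      postStd (distKernel k) lam (fun j => queryDist q (x j)) (queryDist q z)

/-- The targets `x` are those of the algorithm: almost surely, in each of the `N` rounds the target
maximises the acquisition function determined by the past targets and observations. -/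
def IsUGPUCB {Ω : Type*} [MeasurableSpace Ω] (μ : Measure Ω) (N : ℕ∞) (k : X → X → ℝ)
    (q : Kernel S X) [IsMarkovKernel q] (lam B σν δ : ℝ) (x : ℕ → Ω → S) (y : ℕ → Ω → ℝ) : Prop :=
  ∀ i : ℕ, (i : ℕ∞) < N → ∀ᵐ ω ∂μ, ∀ z : S,
    acquisition k q lam B σν δ (fun j : Fin i => x j ω) (fun j : Fin i => y j ω) z ≤
      acquisition k q lam B σν δ (fun j : Fin i => x j ω) (fun j : Fin i => y j ω) (x i ω)

/-- Uncertain-inputs cumulative regret of `n` rounds. -/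
def cumRegret {Ω : Type*} (q : Kernel S X) (f : X → ℝ) (x : ℕ → Ω → S) (n : ℕ) (ω : Ω) : ℝ :=
  ∑ i ∈ Finset.range n, ((⨆ z : S, ∫ u, f u ∂(q z)) - ∫ u, f u ∂(q (x i ω)))

end Algorithm

end UGP

end

/-! The mean embedding `P ↦ ∫ k(z, ·) dP(z)` turns `distKernel k` into an inner product, and the
reproducing property gives `E_P[f] = ⟪f, meanEmbed P⟫`. The problem is thus a UCB bandit whose arms
are distributions and whose reward is linear in a feature `φ`. Only the total noise `y_t - E[f]`,
which mixes query fluctuation and observation noise, needs care. Conditioning first on the executed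
location and then averaging over its law shows that it is sub-Gaussian given the past, with squared
parameter `σq² + σζ²`.

For normalised noise `ν`, `exp (energy / 2 - infoGain)` is the likelihood ratio of the Gaussian
process marginal `N(0, I + K/lam)` to white noise. Its one-step factor is a ratio of `N(a, v)` to
`N(0, 1)`, with `a` the predictive mean and `v ≥ 1` the predictive variance. This ratio is a
Gaussian average of `exp (θ ν - θ² / 2)`, `θ ~ N(a, v - 1)`, so sub-Gaussianity makes the process a
supermartingale (`SubGaussianGiven.gaussianRatio_le`), and `ville_maximal` bounds the energy
uniformly in time. Cauchy–Schwarz converts this into confidence bounds of width `beta * postStd`.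

On that event each instantaneous regret is at most twice the width. The posterior variances sum to
at most a multiple of the information gain (`sum_postCov_le`), whence the `√(n γ)` rate. The summand
`1` in `beta` cannot be absorbed when `γ` is small; then all features are short (`mul_prior_le`) and
the regret is small whatever is played. -/

noncomputable section

namespace UGP

/-! ### Regularised regression in feature space -/

section Deterministic

open scoped InnerProductSpace

variable {ι H : Type*} [NormedAddCommGroup H] [InnerProductSpace ℝ H]
  {k : ι → ι → ℝ} {φ : ι → H} {lam : ℝ}

/-- The regularised Gram matrix `Kₙ + lam I`. -/
abbrev regGram (k : ι → ι → ℝ) (lam : ℝ) {n : ℕ} (P : Fin n → ι) : Matrix (Fin n) (Fin n) ℝ :=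
  gram k P + lam • (1 : Matrix (Fin n) (Fin n) ℝ)

/-- The self-normalised quadratic form `yᵀ Kₙ (Kₙ + lam I)⁻¹ y`. -/
def energy (k : ι → ι → ℝ) (lam : ℝ) {n : ℕ} (P : Fin n → ι) (y : Fin n → ℝ) : ℝ :=
  y ⬝ᵥ (y - lam • ((regGram k lam P)⁻¹ *ᵥ y))

lemma dotProduct_gram_mulVec (hk : ∀ P Q, k P Q = ⟪φ P, φ Q⟫_ℝ) {n : ℕ} (P : Fin n → ι)
    (a b : Fin n → ℝ) :
    a ⬝ᵥ (gram k P *ᵥ b) = ⟪∑ i, a i • φ (P i), ∑ j, b j • φ (P j)⟫_ℝ := by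
  simp only [dotProduct, Matrix.mulVec, gram, Matrix.of_apply, sum_inner, inner_sum,
    real_inner_smul_left, real_inner_smul_right, hk, Finset.mul_sum]
  rw [Finset.sum_comm]
  exact Finset.sum_congr rfl fun i _ => Finset.sum_congr rfl fun j _ => by ring

lemma gram_isHermitian (hk : ∀ P Q, k P Q = ⟪φ P, φ Q⟫_ℝ) {n : ℕ} (P : Fin n → ι) :
    (gram k P).IsHermitian := by
  ext i j
  simp [gram, hk, real_inner_comm]

lemma regGram_posDef (hk : ∀ P Q, k P Q = ⟪φ P, φ Q⟫_ℝ) (hlam : 0 < lam) {n : ℕ}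
    (P : Fin n → ι) : (regGram k lam P).PosDef := by
  refine Matrix.PosDef.posSemidef_add ?_ (Matrix.PosDef.one.smul hlam)
  refine Matrix.PosSemidef.of_dotProduct_mulVec_nonneg (gram_isHermitian hk P) fun x => ?_
  rw [star_trivial, dotProduct_gram_mulVec hk]
  exact real_inner_self_nonneg

lemma regGram_isUnit_det (hk : ∀ P Q, k P Q = ⟪φ P, φ Q⟫_ℝ) (hlam : 0 < lam) {n : ℕ}
    (P : Fin n → ι) : IsUnit (regGram k lam P).det :=
  (regGram_posDef hk hlam P).det_pos.ne'.isUnit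

/-- Naming the solution `b` of the regularised system lets later identities be proved from a linear
equation, free of matrix inverses. -/
lemma exists_regGram_mulVec_eq (hk : ∀ P Q, k P Q = ⟪φ P, φ Q⟫_ℝ) (hlam : 0 < lam) {n : ℕ}
    (P : Fin n → ι) (y : Fin n → ℝ) : ∃ b, (regGram k lam P)⁻¹ *ᵥ y = b ∧
      y = gram k P *ᵥ b + lam • b := by
  refine ⟨_, rfl, ?_⟩
  have h : regGram k lam P *ᵥ ((regGram k lam P)⁻¹ *ᵥ y) = y := by
    rw [Matrix.mulVec_mulVec, Matrix.mul_nonsing_inv _ (regGram_isUnit_det hk hlam P),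
      Matrix.one_mulVec]
  conv_lhs => rw [← h]
  rw [Matrix.add_mulVec, Matrix.smul_mulVec, Matrix.one_mulVec]

lemma kvec_dotProduct (hk : ∀ P Q, k P Q = ⟪φ P, φ Q⟫_ℝ) {n : ℕ} (P : Fin n → ι) (Q : ι)
    (b : Fin n → ℝ) : kvec k P Q ⬝ᵥ b = ⟪φ Q, ∑ j, b j • φ (P j)⟫_ℝ := by
  simp only [dotProduct, kvec, hk, inner_sum, real_inner_smul_right]
  exact Finset.sum_congr rfl fun j _ => mul_comm _ _

/-- The posterior variance as a squared norm. -/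
lemma postCov_eq_norm_sq (hk : ∀ P Q, k P Q = ⟪φ P, φ Q⟫_ℝ) {n : ℕ}
    (P : Fin n → ι) (Q : ι) (a : Fin n → ℝ) (ha : kvec k P Q = gram k P *ᵥ a + lam • a)
    (ha' : (regGram k lam P)⁻¹ *ᵥ kvec k P Q = a) :
    postCov k lam P Q Q = ‖φ Q - ∑ j, a j • φ (P j)‖ ^ 2 + lam * (a ⬝ᵥ a) := by
  have h : a ⬝ᵥ kvec k P Q = ‖∑ j, a j • φ (P j)‖ ^ 2 + lam * (a ⬝ᵥ a) := by
    rw [ha, dotProduct_add, dotProduct_gram_mulVec hk, dotProduct_smul, smul_eq_mul,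
      real_inner_self_eq_norm_sq]
  rw [dotProduct_comm, kvec_dotProduct hk] at h
  rw [postCov, ha', kvec_dotProduct hk, norm_sub_sq_real, hk, real_inner_self_eq_norm_sq]
  linarith

lemma dotProduct_self_nonneg_real {n : ℕ} (a : Fin n → ℝ) : 0 ≤ a ⬝ᵥ a :=
  Finset.sum_nonneg fun i _ => mul_self_nonneg (a i)

lemma postCov_nonneg (hk : ∀ P Q, k P Q = ⟪φ P, φ Q⟫_ℝ) (hlam : 0 < lam) {n : ℕ}
    (P : Fin n → ι) (Q : ι) : 0 ≤ postCov k lam P Q Q := by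
  obtain ⟨a, ha', ha⟩ := exists_regGram_mulVec_eq hk hlam P (kvec k P Q)
  rw [postCov_eq_norm_sq hk P Q a ha ha']
  have := dotProduct_self_nonneg_real a
  positivity

lemma postCov_le (hk : ∀ P Q, k P Q = ⟪φ P, φ Q⟫_ℝ) (hlam : 0 < lam) {n : ℕ}
    (P : Fin n → ι) (Q : ι) : postCov k lam P Q Q ≤ k Q Q := by
  rw [postCov, sub_le_self_iff]
  simpa using (regGram_posDef hk hlam P).inv.posSemidef.dotProduct_mulVec_nonneg (kvec k P Q)

lemma postMean_add {n : ℕ} (P : Fin n → ι) (y y' : Fin n → ℝ) (Q : ι) :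
    postMean k lam P (fun j => y j + y' j) Q = postMean k lam P y Q + postMean k lam P y' Q := by
  rw [postMean, postMean, postMean, ← dotProduct_add, ← Matrix.mulVec_add]
  rfl

lemma postMean_smul {n : ℕ} (P : Fin n → ι) (c : ℝ) (y : Fin n → ℝ) (Q : ι) :
    postMean k lam P (fun j => c * y j) Q = c * postMean k lam P y Q := by
  rw [postMean, postMean, ← smul_eq_mul, ← dotProduct_smul, ← Matrix.mulVec_smul]
  rfl

lemma regGram_inv_symm (hk : ∀ P Q, k P Q = ⟪φ P, φ Q⟫_ℝ) {n : ℕ} (P : Fin n → ι)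
    (u v : Fin n → ℝ) :
    u ⬝ᵥ ((regGram k lam P)⁻¹ *ᵥ v) = v ⬝ᵥ ((regGram k lam P)⁻¹ *ᵥ u) := by
  have hT : (regGram k lam P)⁻¹ᵀ = (regGram k lam P)⁻¹ := by
    rw [Matrix.transpose_nonsing_inv]
    congr 1
    ext i j
    simp [gram, hk, real_inner_comm, Matrix.one_apply, eq_comm]
  rw [Matrix.dotProduct_mulVec, ← Matrix.mulVec_transpose, hT, dotProduct_comm]

/-- The error of the posterior mean computed from exact values of `⟪f, φ ·⟫`. -/
lemma abs_postMean_exact_sub_le (hk : ∀ P Q, k P Q = ⟪φ P, φ Q⟫_ℝ) (hlam : 0 < lam) {n : ℕ}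
    (P : Fin n → ι) (Q : ι) (f : H) :
    |postMean k lam P (fun j => ⟪f, φ (P j)⟫_ℝ) Q - ⟪f, φ Q⟫_ℝ| ≤ ‖f‖ * postStd k lam P Q := by
  obtain ⟨a, ha', ha⟩ := exists_regGram_mulVec_eq hk hlam P (kvec k P Q)
  have h : postMean k lam P (fun j => ⟪f, φ (P j)⟫_ℝ) Q
      = ⟪f, ∑ j, a j • φ (P j)⟫_ℝ := by
    rw [postMean, ← regGram, regGram_inv_symm hk, ha', dotProduct, inner_sum]
    simp only [real_inner_smul_right]
    exact Finset.sum_congr rfl fun j _ => mul_comm _ _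
  rw [h, abs_sub_comm, ← inner_sub_right]
  refine (abs_real_inner_le_norm _ _).trans ?_
  gcongr
  rw [postStd, postCov_eq_norm_sq hk P Q a ha ha']
  -- The variance is the squared residual plus the penalty `lam * (a ⬝ᵥ a)`, which is discarded.
  refine Real.le_sqrt_of_sq_le ?_
  have := mul_nonneg hlam.le (dotProduct_self_nonneg_real a)
  linarith

/-- Writing the energy as a weighted sum of two squares matches the decomposition of the variance in
`postCov_eq_norm_sq`, so that the two can be paired by Cauchy–Schwarz. -/
lemma energy_eq (hk : ∀ P Q, k P Q = ⟪φ P, φ Q⟫_ℝ) {n : ℕ}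
    (P : Fin n → ι) (y b : Fin n → ℝ) (hb : y = gram k P *ᵥ b + lam • b)
    (hb' : (regGram k lam P)⁻¹ *ᵥ y = b) :
    energy k lam P y = (gram k P *ᵥ b) ⬝ᵥ (gram k P *ᵥ b) +
      lam * ‖∑ j, b j • φ (P j)‖ ^ 2 := by
  have h1 : y - lam • b = gram k P *ᵥ b := by rw [hb]; simp
  rw [energy, hb', h1]
  conv_lhs => rw [hb]
  rw [add_dotProduct, smul_dotProduct, dotProduct_gram_mulVec hk P b b, real_inner_self_eq_norm_sq,
    smul_eq_mul]

lemma energy_nonneg (hk : ∀ P Q, k P Q = ⟪φ P, φ Q⟫_ℝ) (hlam : 0 < lam) {n : ℕ}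
    (P : Fin n → ι) (y : Fin n → ℝ) : 0 ≤ energy k lam P y := by
  obtain ⟨b, hb', hb⟩ := exists_regGram_mulVec_eq hk hlam P y
  rw [energy_eq hk P y b hb hb']
  have := dotProduct_self_nonneg_real (gram k P *ᵥ b)
  positivity

/-- The posterior mean of pure noise is controlled by the self-normalised quadratic form. -/
lemma abs_postMean_le (hk : ∀ P Q, k P Q = ⟪φ P, φ Q⟫_ℝ) (hlam : 0 < lam) {n : ℕ}
    (P : Fin n → ι) (Q : ι) (y : Fin n → ℝ) :
    |postMean k lam P y Q| ≤ √(energy k lam P y / lam) * postStd k lam P Q := by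
  obtain ⟨a, ha', ha⟩ := exists_regGram_mulVec_eq hk hlam P (kvec k P Q)
  obtain ⟨b, hb', hb⟩ := exists_regGram_mulVec_eq hk hlam P y
  -- In `H ⊕ ℝⁿ` this is the inner product of `(φ Q - ∑ aⱼ φ(Pⱼ), √lam a)` and `(∑ bⱼ φ(Pⱼ), K b /
  -- √lam)`, whose squared norms are the variance and `energy / lam`.
  have hm : postMean k lam P y Q = ⟪φ Q - ∑ j, a j • φ (P j), ∑ j, b j • φ (P j)⟫_ℝ +
      a ⬝ᵥ (gram k P *ᵥ b) := by
    rw [postMean, hb', kvec_dotProduct hk, inner_sub_left, dotProduct_gram_mulVec hk]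
    ring
  have h1 := abs_real_inner_le_norm (φ Q - ∑ j, a j • φ (P j)) (∑ j, b j • φ (P j))
  have h2 : (a ⬝ᵥ (gram k P *ᵥ b)) ^ 2 ≤ (a ⬝ᵥ a) * ((gram k P *ᵥ b) ⬝ᵥ (gram k P *ᵥ b)) := by
    simpa only [dotProduct, sq] using
      Finset.sum_mul_sq_le_sq_mul_sq Finset.univ a (gram k P *ᵥ b)
  rw [postStd, ← Real.sqrt_mul (div_nonneg (energy_nonneg hk hlam P y) hlam.le)]
  refine Real.abs_le_sqrt ?_
  rw [hm, postCov_eq_norm_sq hk P Q a ha ha', energy_eq hk P y b hb hb']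
  set g := φ Q - ∑ j, a j • φ (P j)
  set w := ∑ j, b j • φ (P j)
  set c := gram k P *ᵥ b
  have ha0 := dotProduct_self_nonneg_real a
  have hc0 := dotProduct_self_nonneg_real c
  obtain ⟨s, hs⟩ : ∃ s, s = √(a ⬝ᵥ a) := ⟨_, rfl⟩
  obtain ⟨t, ht⟩ : ∃ t, t = √(c ⬝ᵥ c) := ⟨_, rfl⟩
  have hs2 : a ⬝ᵥ a = s ^ 2 := by rw [hs, Real.sq_sqrt ha0]
  have ht2 : c ⬝ᵥ c = t ^ 2 := by rw [ht, Real.sq_sqrt hc0]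
  have hs0 : 0 ≤ s := hs ▸ Real.sqrt_nonneg _
  have ht0 : 0 ≤ t := ht ▸ Real.sqrt_nonneg _
  rw [hs2, ht2] at h2 ⊢
  have h3 : |a ⬝ᵥ c| ≤ s * t := abs_le_of_sq_le_sq (by rw [mul_pow]; exact h2) (by positivity)
  have h4 : |⟪g, w⟫_ℝ + a ⬝ᵥ c| ≤ ‖g‖ * ‖w‖ + s * t := (abs_add_le _ _).trans (add_le_add h1 h3)
  calc (⟪g, w⟫_ℝ + a ⬝ᵥ c) ^ 2 ≤ (‖g‖ * ‖w‖ + s * t) ^ 2 := by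
        rw [← sq_abs]; gcongr
    -- Lagrange's identity: the Cauchy–Schwarz defect is an explicit square.
    _ = (t ^ 2 + lam * ‖w‖ ^ 2) / lam * (‖g‖ ^ 2 + lam * s ^ 2)
          - (‖g‖ * t - lam * s * ‖w‖) ^ 2 / lam := by field_simp; ring
    _ ≤ _ := by
        have : 0 ≤ (‖g‖ * t - lam * s * ‖w‖) ^ 2 / lam := by positivity
        linarith

lemma regGram_succ_mulVec_castSucc (P : ℕ → ι) (n : ℕ) (b : Fin n → ℝ) (r : ℝ) (i : Fin n) :
    (regGram k lam (fun j : Fin (n + 1) => P j) *ᵥ (Fin.snoc b r : Fin (n + 1) → ℝ)) i.castSucc =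
      (gram k (fun j : Fin n => P j) *ᵥ b + lam • b) i + k (P i) (P n) * r := by
  rw [Matrix.add_mulVec, Matrix.smul_mulVec, Matrix.one_mulVec]
  simp [Matrix.mulVec, dotProduct, Fin.sum_univ_castSucc, gram]
  ring

lemma regGram_succ_mulVec_last (P : ℕ → ι) (n : ℕ) (b : Fin n → ℝ) (r : ℝ) :
    (regGram k lam (fun j : Fin (n + 1) => P j) *ᵥ (Fin.snoc b r : Fin (n + 1) → ℝ)) (Fin.last n) =
      kvec k (fun j : Fin n => P j) (P n) ⬝ᵥ b + (k (P n) (P n) + lam) * r := by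
  rw [Matrix.add_mulVec, Matrix.smul_mulVec, Matrix.one_mulVec]
  simp [Matrix.mulVec, dotProduct, Fin.sum_univ_castSucc, gram, kvec]
  ring

lemma energy_succ (hk : ∀ P Q, k P Q = ⟪φ P, φ Q⟫_ℝ) (hlam : 0 < lam) (P : ℕ → ι) (y : ℕ → ℝ)
    (n : ℕ) :
    energy k lam (fun j : Fin (n + 1) => P j) (fun j => y j) =
      energy k lam (fun j : Fin n => P j) (fun j => y j) + y n ^ 2 -
        lam * (y n - postMean k lam (fun j : Fin n => P j) (fun j => y j) (P n)) ^ 2 /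
          (lam + postCov k lam (fun j : Fin n => P j) (P n) (P n)) := by
  obtain ⟨a, ha', ha⟩ := exists_regGram_mulVec_eq hk hlam (fun j : Fin n => P j)
    (kvec k (fun j : Fin n => P j) (P n))
  obtain ⟨b, hb', hb⟩ := exists_regGram_mulVec_eq hk hlam (fun j : Fin n => P j) (fun j => y j)
  have hs := postCov_nonneg hk hlam (fun j : Fin n => P j) (P n)
  set s := postCov k lam (fun j : Fin n => P j) (P n) (P n) with hs_def
  set m := postMean k lam (fun j : Fin n => P j) (fun j => y j) (P n) with hm_def
  have hm : kvec k (fun j : Fin n => P j) (P n) ⬝ᵥ b = m := by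
    rw [hm_def, postMean, hb']
  have hs' : kvec k (fun j : Fin n => P j) (P n) ⬝ᵥ a = k (P n) (P n) - s := by
    rw [hs_def, postCov, ha']; ring
  have hpos : lam + s ≠ 0 := by positivity
  -- Block elimination of the bordered system: the last coordinate is the prediction error over the
  -- Schur complement `lam + s`, and the earlier ones are corrected by `-r • a`.
  set r := (y n - m) / (lam + s) with hr
  have hsol : regGram k lam (fun j : Fin (n + 1) => P j) *ᵥ
      (Fin.snoc (b - r • a) r : Fin (n + 1) → ℝ) = fun j : Fin (n + 1) => y j := by
    funext i
    refine Fin.lastCases ?_ (fun i => ?_) i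
    · rw [regGram_succ_mulVec_last, dotProduct_sub, dotProduct_smul, hm, hs', hr, Fin.val_last,
        smul_eq_mul]
      field_simp
      ring
    · rw [regGram_succ_mulVec_castSucc]
      have h1 := congrFun ha i
      have h2 := congrFun hb i
      simp only [Matrix.mulVec_sub, Matrix.mulVec_smul, Pi.add_apply, Pi.sub_apply, Pi.smul_apply,
        smul_eq_mul, kvec, Fin.val_castSucc] at h1 h2 ⊢
      rw [h2, hk, real_inner_comm, ← hk, h1]
      ring
  have hinv : (regGram k lam (fun j : Fin (n + 1) => P j))⁻¹ *ᵥ (fun j : Fin (n + 1) => y j) =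
      (Fin.snoc (b - r • a) r : Fin (n + 1) → ℝ) := by
    rw [← hsol, Matrix.mulVec_mulVec,
      Matrix.nonsing_inv_mul _ (regGram_isUnit_det hk hlam (fun j : Fin (n + 1) => P j)),
      Matrix.one_mulVec]
  have hya : (fun j : Fin n => y j) ⬝ᵥ a = m := by
    rw [← ha', regGram_inv_symm hk, hb', hm]
  rw [energy, energy, hinv, hb', dotProduct_sub, dotProduct_sub, dotProduct_smul, dotProduct_smul]
  have e1 : (fun j : Fin (n + 1) => y j) ⬝ᵥ (Fin.snoc (b - r • a) r : Fin (n + 1) → ℝ) =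
      (fun j : Fin n => y j) ⬝ᵥ b - r * m + y n * r := by
    rw [← hya, ← smul_eq_mul, ← dotProduct_smul, ← dotProduct_sub]
    simp [dotProduct, Fin.sum_univ_castSucc]
  have e2 : (fun j : Fin (n + 1) => y j) ⬝ᵥ (fun j : Fin (n + 1) => y j) =
      (fun j : Fin n => y j) ⬝ᵥ (fun j : Fin n => y j) + y n * y n := by
    simp [dotProduct, Fin.sum_univ_castSucc]
  rw [e1, e2, hr]
  simp only [smul_eq_mul]
  field_simp
  ring

/-- The Schur complement of the old block in the bordered matrix is `lam` plus the posterior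
variance of the new input. This gives the chain rule for the information gain. -/
lemma det_regGram_succ (hk : ∀ P Q, k P Q = ⟪φ P, φ Q⟫_ℝ) (hlam : 0 < lam) (P : ℕ → ι) (n : ℕ) :
    (regGram k lam (fun j : Fin (n + 1) => P j)).det =
      (regGram k lam (fun j : Fin n => P j)).det *
        (lam + postCov k lam (fun j : Fin n => P j) (P n) (P n)) := by
  set A := regGram k lam (fun j : Fin n => P j) with hA
  let v := kvec k (fun j : Fin n => P j) (P n)
  have hu : IsUnit A.det := regGram_isUnit_det hk hlam (fun j : Fin n => P j)
  have : Invertible A := Matrix.invertibleOfIsUnitDet _ hu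
  have hsub : (regGram k lam (fun j : Fin (n + 1) => P j)).submatrix
      (finSumFinEquiv (m := n) (n := 1)) (finSumFinEquiv (m := n) (n := 1)) =
      Matrix.fromBlocks A (Matrix.of fun i (_ : Fin 1) => v i) (Matrix.of fun (_ : Fin 1) i => v i)
        (Matrix.of fun _ _ => k (P n) (P n) + lam) := by
    ext i j
    rcases i with i | i <;> rcases j with j | j
    · simp [hA, gram, Matrix.one_apply, Fin.ext_iff]
    · have : (i : ℕ) ≠ n := i.2.ne
      simp [gram, Fin.ext_iff, v, kvec, this, hk, real_inner_comm]
    · have : n ≠ (j : ℕ) := j.2.ne'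
      simp [gram, Fin.ext_iff, v, kvec, this]
    · simp [gram, Matrix.one_apply, Fin.ext_iff]
  rw [← Matrix.det_submatrix_equiv_self (finSumFinEquiv (m := n) (n := 1)), hsub,
    Matrix.det_fromBlocks₁₁, Matrix.invOf_eq_nonsing_inv]
  congr 1
  have : ((Matrix.of fun (_ : Fin 1) i => v i) * A⁻¹ * (Matrix.of fun i (_ : Fin 1) => v i))
      default default = v ⬝ᵥ (A⁻¹ *ᵥ v) := by
    rw [Matrix.dotProduct_mulVec]
    rfl
  rw [Matrix.det_unique (n := Fin 1), Matrix.sub_apply, this, postCov]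
  simp [v, A]
  ring

lemma one_add_gram_eq_smul_regGram (hlam : 0 < lam) {n : ℕ} (P : Fin n → ι) :
    1 + lam⁻¹ • gram k P = lam⁻¹ • regGram k lam P := by
  rw [regGram, smul_add, smul_smul, inv_mul_cancel₀ hlam.ne', one_smul, add_comm]

lemma det_one_add_gram_pos (hk : ∀ P Q, k P Q = ⟪φ P, φ Q⟫_ℝ) (hlam : 0 < lam) {n : ℕ}
    (P : Fin n → ι) : 0 < (1 + lam⁻¹ • gram k P).det := by
  rw [one_add_gram_eq_smul_regGram hlam]
  exact ((regGram_posDef hk hlam P).smul (inv_pos.2 hlam)).det_pos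

lemma infoGain_succ (hk : ∀ P Q, k P Q = ⟪φ P, φ Q⟫_ℝ) (hlam : 0 < lam) (P : ℕ → ι) (n : ℕ) :
    infoGain k lam (fun j : Fin (n + 1) => P j) = infoGain k lam (fun j : Fin n => P j) +
      1 / 2 * Real.log (1 + postCov k lam (fun j : Fin n => P j) (P n) (P n) / lam) := by
  have hs := postCov_nonneg hk hlam (fun j : Fin n => P j) (P n)
  rw [infoGain, infoGain, ← mul_add, ← Real.log_mul (det_one_add_gram_pos hk hlam _).ne'
    (by positivity)]
  congr 2
  rw [one_add_gram_eq_smul_regGram hlam, one_add_gram_eq_smul_regGram hlam, Matrix.det_smul,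
    Matrix.det_smul, det_regGram_succ hk hlam]
  simp only [Fintype.card_fin]
  rw [pow_succ]
  field_simp

lemma infoGain_zero (P : Fin 0 → ι) : infoGain k lam P = 0 := by
  simp [infoGain]

lemma energy_zero (P : Fin 0 → ι) (y : Fin 0 → ℝ) : energy k lam P y = 0 := by
  simp [energy, dotProduct]

end Deterministic

/-! ### Predictable tilts, Gaussian mixtures and Ville's inequality -/

section Probability

/-- Conditional sub-Gaussianity expressed through integrals against nonnegative `m`-measurable
weights. -/
def SubGaussianGiven {Ω : Type*} (m : MeasurableSpace Ω) [MeasurableSpace Ω] (Y : Ω → ℝ) (σ : ℝ) (μ : Measure Ω) : Prop :=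
  ∀ (s : ℝ) (Z : Ω → ℝ≥0∞), Measurable[m] Z →
    ∫⁻ ω, Z ω * ENNReal.ofReal (Real.exp (s * Y ω - s ^ 2 * σ ^ 2 / 2)) ∂μ ≤ ∫⁻ ω, Z ω ∂μ

variable {Ω : Type*} {m : MeasurableSpace Ω} [mΩ : MeasurableSpace Ω] {μ : Measure Ω}

/-- The hypothesis compares the measures with densities `g` and `h` after restriction to `m`; an
`m`-measurable weight sees only these restrictions. -/
lemma lintegral_mul_le_of_forall_setLIntegral_le (hm : m ≤ mΩ) {g h : Ω → ℝ≥0∞}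
    (hg : Measurable g) (hh : Measurable h)
    (hgh : ∀ A, MeasurableSet[m] A → ∫⁻ ω in A, g ω ∂μ ≤ ∫⁻ ω in A, h ω ∂μ) {Z : Ω → ℝ≥0∞}
    (hZ : Measurable[m] Z) : ∫⁻ ω, Z ω * g ω ∂μ ≤ ∫⁻ ω, Z ω * h ω ∂μ := by
  have hle : (μ.withDensity g).trim hm ≤ (μ.withDensity h).trim hm := by
    refine Measure.le_iff.2 fun A hA => ?_
    rw [trim_measurableSet_eq hm hA, trim_measurableSet_eq hm hA, withDensity_apply _ (hm A hA),
      withDensity_apply _ (hm A hA)]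
    exact hgh A hA
  have key : ∀ g : Ω → ℝ≥0∞, Measurable g →
      ∫⁻ ω, Z ω * g ω ∂μ = ∫⁻ ω, Z ω ∂((μ.withDensity g).trim hm) := fun g hg => by
    rw [lintegral_trim hm hZ, lintegral_withDensity_eq_lintegral_mul _ hg (hZ.mono hm le_rfl)]
    exact lintegral_congr fun ω => mul_comm _ _
  rw [key g hg, key h hh]
  exact lintegral_mono' hle le_rfl

lemma CondSubGaussian.subGaussianGiven [IsFiniteMeasure μ] (hm : m ≤ mΩ) {Y : Ω → ℝ} {σ : ℝ≥0}
    (hY : Measurable Y) (h : CondSubGaussian m Y σ μ) : SubGaussianGiven m Y σ μ := by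
  intro s Z hZ
  obtain ⟨hint, hle⟩ := h s
  have hmain := lintegral_mul_le_of_forall_setLIntegral_le (μ := μ) hm
    (g := fun ω => ENNReal.ofReal (Real.exp (s * Y ω - s ^ 2 * σ ^ 2 / 2))) (h := fun _ => 1)
    (by fun_prop) (by fun_prop) (fun A hA => ?_) hZ
  · simpa using hmain
  have hexp : ∀ ω, Real.exp (s * Y ω - s ^ 2 * (σ : ℝ) ^ 2 / 2) =
      Real.exp (s * Y ω) * Real.exp (-(s ^ 2 * (σ : ℝ) ^ 2 / 2)) := fun ω => by
    rw [← Real.exp_add]; ring_nf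
  simp_rw [hexp]
  rw [← ofReal_integral_eq_lintegral_ofReal (hint.integrableOn.mul_const _)
    (Filter.Eventually.of_forall fun ω => by positivity), integral_mul_const,
    ← setIntegral_condExp hm hint hA]
  have h1 : ∫ ω in A, (μ[fun ω => Real.exp (s * Y ω) | m]) ω ∂μ ≤
      ∫ ω in A, Real.exp (s ^ 2 * (σ : ℝ) ^ 2 / 2) ∂μ :=
    setIntegral_mono_ae integrable_condExp.integrableOn (integrable_const _) hle
  rw [setIntegral_const, smul_eq_mul] at h1
  calc _ ≤ ENNReal.ofReal (μ.real A * Real.exp (s ^ 2 * (σ : ℝ) ^ 2 / 2) *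
        Real.exp (-(s ^ 2 * (σ : ℝ) ^ 2 / 2))) := by gcongr
    _ = ∫⁻ _ in A, 1 ∂μ := by
      rw [mul_assoc, ← Real.exp_add]
      simp

/-- On each level set of `θ` the tilt is constant, and the indicator of that set can be absorbed
into the weight `Z`. -/
lemma SubGaussianGiven.simpleFunc (hm : m ≤ mΩ) {Y : Ω → ℝ} {σ : ℝ} (hY : Measurable Y)
    (h : SubGaussianGiven m Y σ μ) (θ : @SimpleFunc Ω m ℝ) {Z : Ω → ℝ≥0∞} (hZ : Measurable[m] Z) :
    ∫⁻ ω, Z ω * ENNReal.ofReal (Real.exp (θ ω * Y ω - θ ω ^ 2 * σ ^ 2 / 2)) ∂μ ≤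
      ∫⁻ ω, Z ω ∂μ := by
  have hset : ∀ c : ℝ, MeasurableSet[m] (θ ⁻¹' {c}) := fun c =>
    @SimpleFunc.measurableSet_preimage Ω ℝ m θ {c}
  have hsum : ∀ (G : ℝ → Ω → ℝ≥0∞) (ω : Ω), Z ω * G (θ ω) ω =
      ∑ c ∈ @SimpleFunc.range Ω ℝ m θ, (θ ⁻¹' {c}).indicator Z ω * G c ω := fun G ω => by
    rw [Finset.sum_eq_single (θ ω)]
    · rw [Set.indicator_of_mem (by simp)]
    · intro c _ hc
      rw [Set.indicator_of_notMem (by simpa using hc.symm), zero_mul]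
    · intro hn
      exact (hn (@SimpleFunc.mem_range_self Ω ℝ m θ ω)).elim
  have hZc : ∀ c : ℝ, Measurable[m] ((θ ⁻¹' {c}).indicator Z) := fun c => hZ.indicator (hset c)
  have hZc' : ∀ c : ℝ, Measurable ((θ ⁻¹' {c}).indicator Z) := fun c => (hZc c).mono hm le_rfl
  calc _ = ∑ c ∈ @SimpleFunc.range Ω ℝ m θ, ∫⁻ ω, (θ ⁻¹' {c}).indicator Z ω *
        ENNReal.ofReal (Real.exp (c * Y ω - c ^ 2 * σ ^ 2 / 2)) ∂μ := by
        rw [← lintegral_finsetSum _ fun c _ => (show Measurable fun ω => (θ ⁻¹' {c}).indicator Z ω *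
          ENNReal.ofReal (Real.exp (c * Y ω - c ^ 2 * σ ^ 2 / 2)) from (hZc' c).mul (by fun_prop))]
        exact lintegral_congr fun ω =>
          hsum (fun c ω => ENNReal.ofReal (Real.exp (c * Y ω - c ^ 2 * σ ^ 2 / 2))) ω
    _ ≤ ∑ c ∈ @SimpleFunc.range Ω ℝ m θ, ∫⁻ ω, (θ ⁻¹' {c}).indicator Z ω ∂μ :=
        Finset.sum_le_sum fun c _ => h c _ (hZc c)
    _ = ∫⁻ ω, Z ω ∂μ := by
        rw [← lintegral_finsetSum _ fun c _ => hZc' c]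
        exact lintegral_congr fun ω => by simpa using (hsum (fun _ _ => 1) ω).symm

/-- Simple functions approximate `θ` pointwise, and Fatou's lemma preserves the inequality in the
limit. -/
lemma SubGaussianGiven.random (hm : m ≤ mΩ) {Y : Ω → ℝ} {σ : ℝ} (hY : Measurable Y)
    (h : SubGaussianGiven m Y σ μ) {θ : Ω → ℝ} (hθ : Measurable[m] θ) {Z : Ω → ℝ≥0∞}
    (hZ : Measurable[m] Z) :
    ∫⁻ ω, Z ω * ENNReal.ofReal (Real.exp (θ ω * Y ω - θ ω ^ 2 * σ ^ 2 / 2)) ∂μ ≤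
      ∫⁻ ω, Z ω ∂μ := by
  have hθ' : StronglyMeasurable[m] θ := hθ.stronglyMeasurable
  have hlim : ∀ ω, Filter.Tendsto (fun n => ENNReal.ofReal (Real.exp (hθ'.approx n ω * Y ω -
      hθ'.approx n ω ^ 2 * σ ^ 2 / 2))) Filter.atTop
      (nhds (ENNReal.ofReal (Real.exp (θ ω * Y ω - θ ω ^ 2 * σ ^ 2 / 2)))) := fun ω => by
    have hc : Continuous fun t : ℝ =>
      ENNReal.ofReal (Real.exp (t * Y ω - t ^ 2 * σ ^ 2 / 2)) :=
      ENNReal.continuous_ofReal.comp (by fun_prop)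
    exact (hc.tendsto _).comp (hθ'.tendsto_approx ω)
  have happ : ∀ n, Measurable (hθ'.approx n) := fun n =>
    (@SimpleFunc.measurable Ω ℝ m _ (hθ'.approx n)).mono hm le_rfl
  calc _ ≤ ∫⁻ ω, Filter.liminf (fun n => Z ω * ENNReal.ofReal (Real.exp (hθ'.approx n ω * Y ω -
        hθ'.approx n ω ^ 2 * σ ^ 2 / 2))) Filter.atTop ∂μ := by
        refine lintegral_mono fun ω => ?_
        rw [(ENNReal.Tendsto.const_mul (hlim ω) (Or.inl (by simp [Real.exp_pos]))).liminf_eq]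
    _ ≤ Filter.liminf (fun n => ∫⁻ ω, Z ω * ENNReal.ofReal (Real.exp (hθ'.approx n ω * Y ω -
        hθ'.approx n ω ^ 2 * σ ^ 2 / 2)) ∂μ) Filter.atTop :=
        lintegral_liminf_le fun n => (hZ.mono hm le_rfl).mul (by have := happ n; fun_prop)
    _ ≤ Filter.liminf (fun _ : ℕ => ∫⁻ ω, Z ω ∂μ) Filter.atTop := by
        refine Filter.liminf_le_liminf (Filter.Eventually.of_forall fun n => ?_)
        exact h.simpleFunc hm hY (hθ'.approx n) hZ
    _ = _ := by simp

/-- The density ratio of `N(a, v)` and `N(0, 1)`. -/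
def gaussianRatio (a v x : ℝ) : ℝ :=
  Real.exp (x ^ 2 / 2 - (x - a) ^ 2 / (2 * v) - Real.log v / 2)

/-- The density ratio of `N(a, v)` and `N(0, 1)` is a Gaussian mixture of exponentials. -/
lemma ofReal_gaussianRatio_eq_lintegral {a v : ℝ} (hv : 1 ≤ v) (x : ℝ) :
    ENNReal.ofReal (gaussianRatio a v x) = ∫⁻ g, gaussianPDF 0 1 g * ENNReal.ofReal
      (Real.exp ((a + √(v - 1) * g) * x - (a + √(v - 1) * g) ^ 2 / 2)) := by
  have hv0 : 0 < v := by linarith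
  have hw : √(v - 1) ^ 2 = v - 1 := Real.sq_sqrt (by linarith)
  set w := √(v - 1)
  -- Completing the square in `g`: given `x`, the mixing variable has law `N(w (x - a) / v, 1 / v)`,
  -- whose density integrates to one.
  have hpt : ∀ g : ℝ, gaussianPDF 0 1 g * ENNReal.ofReal
      (Real.exp ((a + w * g) * x - (a + w * g) ^ 2 / 2)) =
      ENNReal.ofReal (gaussianRatio a v x) *
        gaussianPDF (w * (x - a) / v) (Real.toNNReal v⁻¹) g := fun g => by
    rw [gaussianPDF, gaussianPDF, ← ENNReal.ofReal_mul (gaussianPDFReal_nonneg _ _ _),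
      ← ENNReal.ofReal_mul (show 0 ≤ gaussianRatio a v x from Real.exp_nonneg _)]
    congr 1
    have hvv : (Real.toNNReal v⁻¹ : ℝ) = v⁻¹ := Real.coe_toNNReal _ (by positivity)
    rw [gaussianPDFReal, gaussianPDFReal, gaussianRatio, hvv, NNReal.coe_one, mul_one]
    have hsq : √(2 * Real.pi * v⁻¹) = √(2 * Real.pi) * (√v)⁻¹ := by
      rw [Real.sqrt_mul (by positivity), Real.sqrt_inv]
    have hlog : Real.exp (-(Real.log v / 2)) = (√v)⁻¹ := by
      rw [Real.exp_neg, ← Real.log_sqrt hv0.le, Real.exp_log (by positivity)]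
    have hsv : √v ≠ 0 := by positivity
    have hexp : -(g - 0) ^ 2 / 2 + ((a + w * g) * x - (a + w * g) ^ 2 / 2) =
        (x ^ 2 / 2 - (x - a) ^ 2 / (2 * v)) + -(g - w * (x - a) / v) ^ 2 / (2 * v⁻¹) := by
      field_simp
      linear_combination ((x - a) ^ 2 - v * g ^ 2) * hw
    calc _ = (√(2 * Real.pi))⁻¹ * Real.exp (-(g - 0) ^ 2 / 2 +
          ((a + w * g) * x - (a + w * g) ^ 2 / 2)) := by rw [Real.exp_add]; ring_nf
      _ = _ := by
        rw [hexp, Real.exp_add, hsq, sub_eq_add_neg _ (Real.log v / 2), Real.exp_add _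
          (-(Real.log v / 2)), hlog]
        field_simp
  simp_rw [hpt]
  rw [lintegral_const_mul _ (measurable_gaussianPDF _ _), lintegral_gaussianPDF_eq_one, mul_one]
  simpa using hv0

/-- By Tonelli the mixing variable `g` can be frozen; then `a + √(v - 1) g` is an `m`-measurable
tilt, to which `SubGaussianGiven.random` applies. -/
lemma SubGaussianGiven.gaussianRatio_le [SFinite μ] (hm : m ≤ mΩ) {Y : Ω → ℝ} (hY : Measurable Y)
    (h : SubGaussianGiven m Y 1 μ) {a v : Ω → ℝ} (ha : Measurable[m] a) (hv : Measurable[m] v)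
    (hv1 : ∀ ω, 1 ≤ v ω) {Z : Ω → ℝ≥0∞} (hZ : Measurable[m] Z) :
    ∫⁻ ω, Z ω * ENNReal.ofReal (gaussianRatio (a ω) (v ω) (Y ω)) ∂μ ≤ ∫⁻ ω, Z ω ∂μ := by
  have ha' : Measurable a := ha.mono hm le_rfl
  have hv' : Measurable v := hv.mono hm le_rfl
  have hZ' : Measurable Z := hZ.mono hm le_rfl
  have hG : Measurable fun p : Ω × ℝ => ENNReal.ofReal (Real.exp ((a p.1 + √(v p.1 - 1) * p.2) *
      Y p.1 - (a p.1 + √(v p.1 - 1) * p.2) ^ 2 / 2)) := by fun_prop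
  calc _ = ∫⁻ ω, (∫⁻ g : ℝ, gaussianPDF 0 1 g * (Z ω * ENNReal.ofReal (Real.exp
        ((a ω + √(v ω - 1) * g) * Y ω - (a ω + √(v ω - 1) * g) ^ 2 / 2)))) ∂μ := by
        refine lintegral_congr fun ω => ?_
        rw [ofReal_gaussianRatio_eq_lintegral (hv1 ω), ← lintegral_const_mul]
        · exact lintegral_congr fun g => mul_left_comm _ _ _
        · exact (measurable_gaussianPDF _ _).mul (by fun_prop)
    _ = ∫⁻ g : ℝ, ∫⁻ ω, gaussianPDF 0 1 g * (Z ω * ENNReal.ofReal (Real.exp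
        ((a ω + √(v ω - 1) * g) * Y ω - (a ω + √(v ω - 1) * g) ^ 2 / 2))) ∂μ := by
        refine lintegral_lintegral_swap (Measurable.aemeasurable ?_)
        exact ((measurable_gaussianPDF _ _).comp measurable_snd).mul
          ((hZ'.comp measurable_fst).mul hG)
    _ ≤ ∫⁻ g : ℝ, gaussianPDF 0 1 g * ∫⁻ ω, Z ω ∂μ := by
        refine lintegral_mono fun g => ?_
        have hg : Measurable fun ω => Z ω * ENNReal.ofReal (Real.exp
            ((a ω + √(v ω - 1) * g) * Y ω - (a ω + √(v ω - 1) * g) ^ 2 / 2)) :=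
          hZ'.mul (by fun_prop)
        rw [lintegral_const_mul _ hg]
        gcongr 1
        have hθ : Measurable[m] fun ω => a ω + √(v ω - 1) * g := by fun_prop
        simpa using h.random hm hY hθ hZ
    _ = _ := by
        rw [lintegral_mul_const _ (measurable_gaussianPDF _ _),
          lintegral_gaussianPDF_eq_one _ one_ne_zero, one_mul]

/-- Ville's maximal inequality for nonnegative supermartingales. -/
lemma ville_maximal (ℱ : Filtration ℕ mΩ) {M : ℕ → Ω → ℝ≥0∞} (hM : ∀ n, Measurable[ℱ n] (M n))
    (hsuper : ∀ n A, MeasurableSet[ℱ n] A → ∫⁻ ω in A, M (n + 1) ω ∂μ ≤ ∫⁻ ω in A, M n ω ∂μ)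
    (c : ℝ≥0∞) : c * μ {ω | ∃ n, c ≤ M n ω} ≤ ∫⁻ ω, M 0 ω ∂μ := by
  have hsets : ∀ n, MeasurableSet[ℱ n] {ω | ∃ j ≤ n, c ≤ M j ω} := fun n => by
    have : {ω | ∃ j ≤ n, c ≤ M j ω} = ⋃ j, ⋃ (_ : j ≤ n), {ω | c ≤ M j ω} := by ext; simp
    rw [this]
    refine MeasurableSet.iUnion fun j => MeasurableSet.iUnion fun hj => ?_
    exact ((hM j).mono (ℱ.mono hj) le_rfl) measurableSet_Ici
  -- The induction invariant is a bound on the process stopped on reaching `c`: paths that have hit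
  -- contribute at least `c`, the others `M n`.
  have hstep : ∀ n, c * μ {ω | ∃ j ≤ n, c ≤ M j ω} +
      ∫⁻ ω in {ω | ∃ j ≤ n, c ≤ M j ω}ᶜ, M n ω ∂μ ≤ ∫⁻ ω, M 0 ω ∂μ := by
    intro n
    induction n with
    | zero =>
      have hs := (ℱ.le 0) _ (hsets 0)
      rw [← lintegral_add_compl (μ := μ) (fun ω => M 0 ω) hs]
      have hle : c * μ {ω | ∃ j ≤ 0, c ≤ M j ω} ≤ ∫⁻ ω in {ω | ∃ j ≤ 0, c ≤ M j ω}, M 0 ω ∂μ := ?_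
      · exact add_le_add hle le_rfl
      rw [← setLIntegral_const]
      refine setLIntegral_mono ((hM 0).mono (ℱ.le 0) le_rfl) fun ω hω => ?_
      obtain ⟨j, hj, h⟩ := hω
      rwa [Nat.le_zero.1 hj] at h
    | succ n ih =>
      refine le_trans ?_ ih
      set U := {ω | ∃ j ≤ n, c ≤ M j ω}
      set V := {ω | c ≤ M (n + 1) ω}
      have hV : MeasurableSet V :=
        measurableSet_le measurable_const ((hM (n + 1)).mono (ℱ.le _) le_rfl)
      have hU : MeasurableSet U := (ℱ.le n) _ (hsets n)
      have hUV : {ω | ∃ j ≤ n + 1, c ≤ M j ω} = U ∪ V := by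
        ext ω
        simp only [U, V, Set.mem_ofPred_eq, Set.mem_union, Nat.le_succ_iff, or_and_right,
          exists_or, exists_eq_left]
      rw [hUV]
      calc c * μ (U ∪ V) + ∫⁻ ω in (U ∪ V)ᶜ, M (n + 1) ω ∂μ
          ≤ c * (μ U + μ (V ∩ Uᶜ)) + ∫⁻ ω in (U ∪ V)ᶜ, M (n + 1) ω ∂μ := by
            gcongr
            refine le_trans (measure_mono ?_) (measure_union_le _ _)
            intro ω hω
            by_cases h : ω ∈ U
            · exact Or.inl h
            · exact Or.inr ⟨hω.resolve_left h, h⟩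
        _ = c * μ U + (∫⁻ _ in V ∩ Uᶜ, c ∂μ + ∫⁻ ω in (U ∪ V)ᶜ, M (n + 1) ω ∂μ) := by
            rw [setLIntegral_const, mul_add, add_assoc]
        _ ≤ c * μ U + (∫⁻ ω in V ∩ Uᶜ, M (n + 1) ω ∂μ + ∫⁻ ω in (U ∪ V)ᶜ, M (n + 1) ω ∂μ) := by
            gcongr 2
            exact setLIntegral_mono ((hM (n + 1)).mono (ℱ.le _) le_rfl) fun ω hω => hω.1
        _ = c * μ U + ∫⁻ ω in Uᶜ, M (n + 1) ω ∂μ := by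
            rw [← lintegral_inter_add_sdiff (fun ω => M (n + 1) ω) Uᶜ hV]
            congr 3
            · rw [Set.inter_comm]
            · rw [Set.compl_union, Set.sdiff_eq]
        _ ≤ c * μ U + ∫⁻ ω in Uᶜ, M n ω ∂μ := by
            gcongr 1
            exact hsuper n _ (hsets n).compl
  have hU : {ω | ∃ n, c ≤ M n ω} = ⋃ n, {ω | ∃ j ≤ n, c ≤ M j ω} := by
    ext ω
    simp only [Set.mem_ofPred_eq, Set.mem_iUnion]
    exact ⟨fun ⟨n, h⟩ => ⟨n, n, le_rfl, h⟩, fun ⟨_, j, _, h⟩ => ⟨j, h⟩⟩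
  have hmono : Monotone fun n => {ω | ∃ j ≤ n, c ≤ M j ω} :=
    fun a b hab ω ⟨j, hj, h⟩ => ⟨j, hj.trans hab, h⟩
  rw [hU, hmono.measure_iUnion, ENNReal.mul_iSup]
  exact iSup_le fun n => le_self_add.trans (hstep n)

end Probability

/-! ### Query fluctuation combined with observation noise -/

section TotalNoise

/-- Rectangles determine the joint law of `(π, ξ)`, which is therefore a composition product.
Keeping `Ω'` general allows `π` to be the identity onto `Ω` with a coarser σ-algebra. -/
lemma lintegral_eq_lintegral_kernel {Ω Ω' X : Type*} [MeasurableSpace Ω] [MeasurableSpace Ω']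
    [MeasurableSpace X] {μ : Measure Ω} [IsFiniteMeasure μ] {π : Ω → Ω'} (hπ : Measurable π)
    {ξ : Ω → X} (hξ : Measurable ξ) (κ : Kernel Ω' X) [IsMarkovKernel κ]
    (h : ∀ A B, MeasurableSet A → MeasurableSet B →
      μ (π ⁻¹' A ∩ ξ ⁻¹' B) = ∫⁻ ω in π ⁻¹' A, κ (π ω) B ∂μ)
    {G : Ω' × X → ℝ≥0∞} (hG : Measurable G) :
    ∫⁻ ω, G (π ω, ξ ω) ∂μ = ∫⁻ ω, ∫⁻ u, G (π ω, u) ∂(κ (π ω)) ∂μ := by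
  have hmeas : μ.map (fun ω => (π ω, ξ ω)) = μ.map π ⊗ₘ κ := by
    refine Measure.ext_prod fun {A B} hA hB => ?_
    rw [Measure.map_apply (by fun_prop) (hA.prod hB), Measure.compProd_apply_prod hA hB,
      setLIntegral_map hA (κ.measurable_coe hB) hπ, ← h A B hA hB]
    rfl
  rw [← lintegral_map (f := G) hG (by fun_prop), hmeas, Measure.lintegral_compProd hG,
    lintegral_map (Measurable.lintegral_kernel_prod_right' hG) hπ]

variable {Ω S X : Type*} {m : MeasurableSpace Ω} [mΩ : MeasurableSpace Ω] [MeasurableSpace S]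
  [mX : MeasurableSpace X] {μ : Measure Ω} {q : Kernel S X} [IsMarkovKernel q]

lemma lintegral_eq_lintegral_of_condLaw [IsFiniteMeasure μ] (hm : m ≤ mΩ) {x : Ω → S}
    (hx : Measurable[m] x) {ξ : Ω → X} (hξ : Measurable ξ)
    (hlaw : ∀ A : Set X, MeasurableSet A →
      μ[(ξ ⁻¹' A).indicator (fun _ => (1 : ℝ)) | m] =ᵐ[μ] fun ω => (q (x ω)).real A)
    {Z : Ω → ℝ≥0∞} (hZ : Measurable[m] Z) {g : S × X → ℝ≥0∞} (hg : Measurable g) :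
    ∫⁻ ω, Z ω * g (x ω, ξ ω) ∂μ = ∫⁻ ω, Z ω * ∫⁻ u, g (x ω, u) ∂(q (x ω)) ∂μ := by
  have hG : Measurable[m.prod mX] fun p : Ω × X => Z p.1 * g (x p.1, p.2) := by
    refine Measurable.mul (hZ.comp (@measurable_fst _ _ m mX)) (hg.comp ?_)
    exact (hx.comp (@measurable_fst _ _ m mX)).prodMk (@measurable_snd _ _ m mX)
  let κ : @Kernel Ω X m mX := q.comap x hx
  have hκ : IsMarkovKernel κ := Kernel.IsMarkovKernel.comap q hx
  have hκx : ∀ ω, κ ω = q (x ω) := fun ω => Kernel.comap_apply q hx ω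
  have key := @lintegral_eq_lintegral_kernel Ω Ω X mΩ m mX μ _ id (measurable_id'' hm) ξ hξ
    κ hκ ?_ _ hG
  · refine key.trans (lintegral_congr fun ω => ?_)
    have h : Measurable fun u => g (x ω, u) := hg.comp measurable_prodMk_left
    change ∫⁻ u, Z ω * g (x ω, u) ∂(κ ω) = _
    rw [hκx, lintegral_const_mul _ h]
  · intro A B hA hB
    have hA' := hm A hA
    have hi : Integrable ((ξ ⁻¹' B).indicator fun _ => (1 : ℝ)) μ :=
      (integrable_const _).indicator (hξ hB)
    have h1 := setIntegral_condExp hm hi hA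
    have hq : Measurable fun ω => (q (x ω)).real B :=
      ((q.measurable_coe hB).comp (hx.mono hm le_rfl)).ennreal_toReal
    rw [setIntegral_congr_ae hA' ((hlaw B hB).mono fun ω h _ => h),
      integral_indicator (hξ hB), setIntegral_const, smul_eq_mul, mul_one, measureReal_restrict_apply
      (hξ hB)] at h1
    have h2 : ∫⁻ ω in A, q (x ω) B ∂μ = ENNReal.ofReal (∫ ω in A, (q (x ω)).real B ∂μ) := by
      rw [ofReal_integral_eq_lintegral_ofReal]
      · exact lintegral_congr fun ω => by simp
      · refine Integrable.of_bound hq.aestronglyMeasurable 1 (Filter.Eventually.of_forall fun ω => ?_)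
        rw [Real.norm_of_nonneg measureReal_nonneg]
        exact measureReal_le_one
      · exact Filter.Eventually.of_forall fun ω => measureReal_nonneg
    change μ (A ∩ ξ ⁻¹' B) = ∫⁻ ω in A, κ ω B ∂μ
    simp only [hκx]
    rw [h2, h1, Set.inter_comm]
    simp

lemma lintegral_exp_le_one_of_hasSubgaussianMGF {ρ : Measure X} {Y : X → ℝ} {σ : ℝ≥0}
    (h : HasSubgaussianMGF Y (σ ^ 2) ρ) (s : ℝ) :
    ∫⁻ u, ENNReal.ofReal (Real.exp (s * Y u - s ^ 2 * (σ : ℝ) ^ 2 / 2)) ∂ρ ≤ 1 := by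
  have hexp : ∀ u, Real.exp (s * Y u - s ^ 2 * (σ : ℝ) ^ 2 / 2) =
      Real.exp (s * Y u) * Real.exp (-(s ^ 2 * (σ : ℝ) ^ 2 / 2)) := fun u => by
    rw [← Real.exp_add]; ring_nf
  simp_rw [hexp]
  rw [← ofReal_integral_eq_lintegral_ofReal ((h.integrable_exp_mul s).mul_const _)
    (Filter.Eventually.of_forall fun u => by positivity), integral_mul_const,
    ← ENNReal.ofReal_one]
  refine ENNReal.ofReal_le_ofReal ?_
  have h1 := h.mgf_le s
  rw [mgf] at h1
  calc _ ≤ Real.exp (((σ ^ 2 : ℝ≥0) : ℝ) * s ^ 2 / 2) * Real.exp (-(s ^ 2 * (σ : ℝ) ^ 2 / 2)) := by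
        gcongr
    _ = 1 := by
        rw [← Real.exp_add, NNReal.coe_pow, Real.exp_eq_one_iff]; ring

/-- The deviation of the observation from its mean under the query distribution combines the
fluctuation of the query location with the observation noise. -/
lemma subGaussianGiven_obs_sub [IsFiniteMeasure μ] (hm : m ≤ mΩ) {x : Ω → S}
    (hx : Measurable[m] x) {ξ : Ω → X} (hξ : Measurable ξ)
    (hlaw : ∀ A : Set X, MeasurableSet A →
      μ[(ξ ⁻¹' A).indicator (fun _ => (1 : ℝ)) | m] =ᵐ[μ] fun ω => (q (x ω)).real A)
    {f : X → ℝ} (hf : Measurable f) {σq σζ : ℝ≥0}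
    (hq : ∀ z : S, HasSubgaussianMGF (fun u => f u - ∫ v, f v ∂(q z)) (σq ^ 2) (q z))
    {ζ : Ω → ℝ} (hζ : Measurable ζ)
    (hnoise : CondSubGaussian (m ⊔ MeasurableSpace.comap ξ mX) ζ σζ μ) :
    SubGaussianGiven m (fun ω => f (ξ ω) + ζ ω - ∫ v, f v ∂(q (x ω)))
      √((σq : ℝ) ^ 2 + (σζ : ℝ) ^ 2) μ := by
  intro s Z hZ
  have hE : Measurable fun z : S => ∫ v, f v ∂(q z) :=
    (StronglyMeasurable.integral_kernel hf.stronglyMeasurable).measurable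
  have hsup : m ⊔ MeasurableSpace.comap ξ mX ≤ mΩ := sup_le hm hξ.comap_le
  set g : S × X → ℝ≥0∞ := fun p =>
    ENNReal.ofReal (Real.exp (s * (f p.2 - ∫ v, f v ∂(q p.1)) - s ^ 2 * (σq : ℝ) ^ 2 / 2)) with hg
  have hgm : Measurable g := by
    have h1 : Measurable fun p : S × X => ∫ v, f v ∂(q p.1) := hE.comp measurable_fst
    have h2 : Measurable fun p : S × X => f p.2 := hf.comp measurable_snd
    fun_prop
  -- Once the location is known its exponential factor is a legitimate weight, so the noise can be
  -- integrated out first.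
  have hW : Measurable[m ⊔ MeasurableSpace.comap ξ mX] fun ω => Z ω * g (x ω, ξ ω) := by
    refine Measurable.mul (hZ.mono le_sup_left le_rfl) (hgm.comp ?_)
    exact (hx.mono le_sup_left le_rfl).prodMk ((comap_measurable ξ).mono le_sup_right le_rfl)
  calc _ = ∫⁻ ω, Z ω * g (x ω, ξ ω) *
        ENNReal.ofReal (Real.exp (s * ζ ω - s ^ 2 * (σζ : ℝ) ^ 2 / 2)) ∂μ := by
        refine lintegral_congr fun ω => ?_
        rw [mul_assoc, hg, ← ENNReal.ofReal_mul (Real.exp_nonneg _), ← Real.exp_add,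
          Real.sq_sqrt (by positivity)]
        congr 3
        ring
    _ ≤ ∫⁻ ω, Z ω * g (x ω, ξ ω) ∂μ := hnoise.subGaussianGiven hsup hζ s _ hW
    _ = ∫⁻ ω, Z ω * ∫⁻ u, g (x ω, u) ∂(q (x ω)) ∂μ :=
        lintegral_eq_lintegral_of_condLaw hm hx hξ hlaw hZ hgm
    _ ≤ ∫⁻ ω, Z ω * 1 ∂μ := by
        gcongr with ω
        exact lintegral_exp_le_one_of_hasSubgaussianMGF (hq (x ω)) s
    _ = _ := by simp

lemma SubGaussianGiven.div {Y : Ω → ℝ} {σ : ℝ} (hσ : σ ≠ 0) (h : SubGaussianGiven m Y σ μ) :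
    SubGaussianGiven m (fun ω => Y ω / σ) 1 μ := by
  intro s Z hZ
  convert h (s / σ) Z hZ using 7
  · ring
  · field_simp

end TotalNoise

/-! ### Kernel mean embeddings -/

section Embedding

open scoped InnerProductSpace

variable {d : ℕ} {X : Set (EuclideanSpace ℝ (Fin d))} {k : X → X → ℝ}
  {H : Type*} [NormedAddCommGroup H] [InnerProductSpace ℝ H] [CompleteSpace H] [RKHS ℝ H X ℝ]

lemma inner_kerFun_one (f : H) (z : X) : ⟪f, RKHS.kerFun H z 1⟫_ℝ = f z := by
  simp

lemma inner_kerFun_kerFun (hk : IsReproducingKernel H k) (z z' : X) :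
    ⟪RKHS.kerFun H z 1, RKHS.kerFun H z' 1⟫_ℝ = k z z' := by
  rw [real_inner_comm, inner_kerFun_one, RKHS.kerFun_apply]
  exact hk z z'

/-- The squared distance between two kernel sections is a combination of kernel values. Continuity
yields the measurability required by the Bochner integral `meanEmbed`. -/
lemma continuous_kerFun (hk : IsReproducingKernel H k)
    (hcont : Continuous fun p : X × X => k p.1 p.2) :
    Continuous fun z : X => RKHS.kerFun H z 1 := by
  rw [continuous_iff_continuousAt]
  intro z
  rw [ContinuousAt, tendsto_iff_norm_sub_tendsto_zero]
  have h : ∀ u : X, ‖RKHS.kerFun H u 1 - RKHS.kerFun H z 1‖ = √(k u u - 2 * k u z + k z z) := by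
    intro u
    rw [← inner_kerFun_kerFun hk, ← inner_kerFun_kerFun hk, ← inner_kerFun_kerFun hk,
      real_inner_self_eq_norm_sq, real_inner_self_eq_norm_sq, ← norm_sub_sq_real,
      Real.sqrt_sq (norm_nonneg _)]
  simp_rw [h]
  have h1 : Continuous fun u : X => k u u := hcont.comp (continuous_id.prodMk continuous_id)
  have h2 : Continuous fun u : X => k u z := hcont.comp (continuous_id.prodMk continuous_const)
  have h3 : Continuous fun u : X => √(k u u - 2 * k u z + k z z) := by fun_prop
  have h4 := h3.tendsto z
  rwa [show k z z - 2 * k z z + k z z = 0 by ring, Real.sqrt_zero] at h4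

lemma norm_kerFun_le (hk : IsReproducingKernel H k) (hk1 : ∀ z, k z z ≤ 1) (z : X) :
    ‖RKHS.kerFun H z 1‖ ≤ 1 := by
  have h := inner_kerFun_kerFun hk z z
  rw [real_inner_self_eq_norm_sq] at h
  exact abs_le_one_iff_mul_self_le_one.2 (by rw [← sq, h]; exact hk1 z) |> (abs_norm _).ge.trans

/-- The kernel mean embedding of a probability measure. -/
def meanEmbed (H : Type*) [NormedAddCommGroup H] [InnerProductSpace ℝ H] [CompleteSpace H]
    [RKHS ℝ H X ℝ] (P : ProbabilityMeasure X) : H :=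
  ∫ z, RKHS.kerFun H z 1 ∂(P : Measure X)

lemma integrable_kerFun (hk : IsReproducingKernel H k)
    (hcont : Continuous fun p : X × X => k p.1 p.2) (hk1 : ∀ z, k z z ≤ 1)
    (P : Measure X) [IsFiniteMeasure P] : Integrable (fun z => RKHS.kerFun H z 1) P :=
  Integrable.of_bound (continuous_kerFun hk hcont).stronglyMeasurable.aestronglyMeasurable 1
    (Filter.Eventually.of_forall (norm_kerFun_le hk hk1))

lemma inner_meanEmbed (hk : IsReproducingKernel H k)
    (hcont : Continuous fun p : X × X => k p.1 p.2) (hk1 : ∀ z, k z z ≤ 1) (f : H)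
    (P : ProbabilityMeasure X) : ⟪f, meanEmbed H P⟫_ℝ = ∫ z, f z ∂(P : Measure X) := by
  rw [meanEmbed, ← integral_inner (integrable_kerFun hk hcont hk1 P)]
  simp

/-- The reproducing property, applied once per integral, moves both integrals inside the inner
product. This makes the results for abstract features `φ` available for distributions. -/
lemma distKernel_eq_inner (hk : IsReproducingKernel H k)
    (hcont : Continuous fun p : X × X => k p.1 p.2) (hk1 : ∀ z, k z z ≤ 1)
    (P P' : ProbabilityMeasure X) :
    distKernel k P P' = ⟪meanEmbed H P, meanEmbed H P'⟫_ℝ := by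
  rw [inner_meanEmbed hk hcont hk1, distKernel]
  refine integral_congr_ae (Filter.Eventually.of_forall fun z' => ?_)
  change ∫ z, k z z' ∂(P : Measure X) = meanEmbed H P z'
  rw [← inner_kerFun_one, real_inner_comm, inner_meanEmbed hk hcont hk1]
  refine integral_congr_ae (Filter.Eventually.of_forall fun z => ?_)
  change k z z' = RKHS.kerFun H z' 1 z
  rw [← inner_kerFun_one, real_inner_comm, inner_kerFun_kerFun hk]

lemma norm_meanEmbed_le (hk : IsReproducingKernel H k) (hk1 : ∀ z, k z z ≤ 1)
    (P : ProbabilityMeasure X) : ‖meanEmbed H P‖ ≤ 1 := by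
  simpa [meanEmbed] using norm_integral_le_of_norm_le_const (μ := (P : Measure X))
    (Filter.Eventually.of_forall (norm_kerFun_le (H := H) hk hk1))

lemma measurable_of_mem_rkhs (hk : IsReproducingKernel H k)
    (hcont : Continuous fun p : X × X => k p.1 p.2) (f : H) : Measurable f := by
  have h : (fun z => f z) = fun z => ⟪f, RKHS.kerFun H z 1⟫_ℝ :=
    funext fun z => (inner_kerFun_one f z).symm
  have hc := continuous_kerFun hk hcont
  have : Continuous fun z => f z := by rw [h]; fun_prop
  exact this.measurable

lemma stronglyMeasurable_meanEmbed_queryDist {S : Type*} [MeasurableSpace S]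
    (hk : IsReproducingKernel H k) (hcont : Continuous fun p : X × X => k p.1 p.2)
    (q : Kernel S X) [IsMarkovKernel q] :
    StronglyMeasurable fun z => meanEmbed H (queryDist q z) :=
  StronglyMeasurable.integral_kernel (continuous_kerFun hk hcont).stronglyMeasurable

end Embedding

/-! ### Measurability of the regression quantities -/

section Measurability

variable {Ω ι : Type*} {m : MeasurableSpace Ω} {n : ℕ}

lemma measurable_det {A : Ω → Matrix (Fin n) (Fin n) ℝ} (hA : ∀ i j, Measurable fun ω => A ω i j) :
    Measurable fun ω => (A ω).det := by
  simp only [Matrix.det_apply]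
  exact Finset.measurable_fun_sum _ fun σ _ =>
    (Finset.measurable_fun_prod _ fun i _ => hA _ _).const_smul _

/-- By Cramer's rule the entries are quotients of determinants; the convention `0⁻¹ = 0` covers
singular matrices. -/
lemma measurable_matrix_inv {A : Ω → Matrix (Fin n) (Fin n) ℝ}
    (hA : ∀ i j, Measurable fun ω => A ω i j) (i j : Fin n) :
    Measurable fun ω => (A ω)⁻¹ i j := by
  simp only [Matrix.inv_def, Matrix.smul_apply, Matrix.adjugate_apply, smul_eq_mul,
    Ring.inverse_eq_inv']
  refine (measurable_det hA).inv.mul (measurable_det fun i' j' => ?_)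
  simp only [Matrix.updateRow_apply]
  split_ifs
  · exact measurable_const
  · exact hA _ _

lemma measurable_dotProduct {u v : Ω → Fin n → ℝ} (hu : ∀ i, Measurable fun ω => u ω i)
    (hv : ∀ i, Measurable fun ω => v ω i) : Measurable fun ω => u ω ⬝ᵥ v ω :=
  Finset.measurable_fun_sum _ fun i _ => (hu i).mul (hv i)

lemma measurable_inv_regGram_mulVec {k : ι → ι → ℝ} {lam : ℝ} {P : Fin n → Ω → ι}
    (hP : ∀ i j, Measurable fun ω => k (P i ω) (P j ω)) {v : Ω → Fin n → ℝ}
    (hv : ∀ i, Measurable fun ω => v ω i) (i : Fin n) :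
    Measurable fun ω => ((regGram k lam fun j => P j ω)⁻¹ *ᵥ v ω) i := by
  refine measurable_dotProduct (fun j => measurable_matrix_inv (fun a b => ?_) i j) hv
  simp only [regGram, gram, Matrix.add_apply, Matrix.smul_apply, Matrix.of_apply]
  exact (hP a b).add_const _

end Measurability

/-! ### Self-normalised concentration -/

section Concentration

open scoped InnerProductSpace

variable {Ω ι H : Type*} [mΩ : MeasurableSpace Ω] {μ : Measure Ω} [IsProbabilityMeasure μ]
  [NormedAddCommGroup H] [InnerProductSpace ℝ H] {k : ι → ι → ℝ} {φ : ι → H} {lam : ℝ}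

/-- The chain rule for likelihoods: the new factor compares the predictive law of `y n` under the
Gaussian process with a standard Gaussian. -/
lemma exp_energy_sub_infoGain_succ (hk : ∀ P Q, k P Q = ⟪φ P, φ Q⟫_ℝ) (hlam : 0 < lam)
    (P : ℕ → ι) (y : ℕ → ℝ) (n : ℕ) :
    Real.exp (energy k lam (fun j : Fin (n + 1) => P j) (fun j => y j) / 2 -
        infoGain k lam fun j : Fin (n + 1) => P j) =
      Real.exp (energy k lam (fun j : Fin n => P j) (fun j => y j) / 2 -
        infoGain k lam fun j : Fin n => P j) *
      gaussianRatio (postMean k lam (fun j : Fin n => P j) (fun j => y j) (P n))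
        (1 + postCov k lam (fun j : Fin n => P j) (P n) (P n) / lam) (y n) := by
  have hs := postCov_nonneg hk hlam (fun j : Fin n => P j) (P n)
  rw [energy_succ hk hlam, infoGain_succ hk hlam, gaussianRatio, ← Real.exp_add]
  congr 1
  have h : lam * (y n - postMean k lam (fun j : Fin n => P j) (fun j => y j) (P n)) ^ 2 /
      (lam + postCov k lam (fun j : Fin n => P j) (P n) (P n)) / 2 =
      (y n - postMean k lam (fun j : Fin n => P j) (fun j => y j) (P n)) ^ 2 /
        (2 * (1 + postCov k lam (fun j : Fin n => P j) (P n) (P n) / lam)) := by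
    field_simp
  rw [← h]
  ring

variable {ℱ : Filtration ℕ mΩ} {N : ℕ∞} {P : ℕ → Ω → ι} {y : ℕ → Ω → ℝ}

/-- The input space `ι` carries no σ-algebra, so adaptedness is imposed on the features, and kernel
values inherit it as inner products. -/
lemma measurable_kernel_of_lt (hk : ∀ P Q, k P Q = ⟪φ P, φ Q⟫_ℝ)
    (hP : ∀ i : ℕ, (i : ℕ∞) < N → StronglyMeasurable[ℱ i] fun ω => φ (P i ω)) {n i j : ℕ}
    (hn : (n : ℕ∞) < N) (hi : i ≤ n) (hj : j ≤ n) :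
    Measurable[ℱ n] fun ω => k (P i ω) (P j ω) := by
  have h : ∀ {l : ℕ}, l ≤ n → StronglyMeasurable[ℱ n] fun ω => φ (P l ω) := fun hl =>
    (hP _ (lt_of_le_of_lt (by exact_mod_cast hl) hn)).mono (ℱ.mono hl)
  simp only [hk]
  exact ((h hi).inner (h hj)).measurable

lemma measurable_postMean_of_lt (hk : ∀ P Q, k P Q = ⟪φ P, φ Q⟫_ℝ)
    (hP : ∀ i : ℕ, (i : ℕ∞) < N → StronglyMeasurable[ℱ i] fun ω => φ (P i ω))
    (hy : ∀ i : ℕ, (i : ℕ∞) < N → Measurable[ℱ (i + 1)] (y i)) {n : ℕ} (hn : (n : ℕ∞) < N) :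
    Measurable[ℱ n] fun ω =>
      postMean k lam (fun j : Fin n => P j ω) (fun j : Fin n => y j ω) (P n ω) := by
  refine measurable_dotProduct (fun i => measurable_kernel_of_lt hk hP hn le_rfl i.2.le)
    (measurable_inv_regGram_mulVec (P := fun (j : Fin n) ω => P j ω)
      (fun i j => measurable_kernel_of_lt hk hP hn i.2.le j.2.le) fun i => ?_)
  exact (hy i (lt_trans (by exact_mod_cast i.2) hn)).mono (ℱ.mono i.2) le_rfl

lemma measurable_postCov_of_lt (hk : ∀ P Q, k P Q = ⟪φ P, φ Q⟫_ℝ)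
    (hP : ∀ i : ℕ, (i : ℕ∞) < N → StronglyMeasurable[ℱ i] fun ω => φ (P i ω)) {n : ℕ}
    (hn : (n : ℕ∞) < N) :
    Measurable[ℱ n] fun ω => postCov k lam (fun j : Fin n => P j ω) (P n ω) (P n ω) := by
  refine (measurable_kernel_of_lt hk hP hn le_rfl le_rfl).sub ?_
  refine measurable_dotProduct (fun i => measurable_kernel_of_lt hk hP hn le_rfl i.2.le)
    (measurable_inv_regGram_mulVec (P := fun (j : Fin n) ω => P j ω)
      (fun i j => measurable_kernel_of_lt hk hP hn i.2.le j.2.le) fun i => ?_)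
  exact measurable_kernel_of_lt hk hP hn le_rfl i.2.le

lemma coe_lt_of_succ_le {n : ℕ} (h : ((n + 1 : ℕ) : ℕ∞) ≤ N) : (n : ℕ∞) < N :=
  lt_of_lt_of_le (by exact_mod_cast n.lt_succ_self) h

/-- Time-uniform self-normalised concentration: with high probability the quadratic form
of the noise is bounded by the information gain. -/
lemma measure_energy_ge_le (hk : ∀ P Q, k P Q = ⟪φ P, φ Q⟫_ℝ) (hlam : 0 < lam)
    (hP : ∀ i : ℕ, (i : ℕ∞) < N → StronglyMeasurable[ℱ i] fun ω => φ (P i ω))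
    (hy : ∀ i : ℕ, (i : ℕ∞) < N → Measurable[ℱ (i + 1)] (y i))
    (hsub : ∀ i : ℕ, (i : ℕ∞) < N → SubGaussianGiven (ℱ i) (y i) 1 μ) {δ : ℝ} (hδ : 0 < δ) :
    μ {ω | ∃ n : ℕ, (n : ℕ∞) ≤ N ∧ Real.log (1 / δ) ≤
      energy k lam (fun j : Fin n => P j ω) (fun j => y j ω) / 2 -
        infoGain k lam fun j : Fin n => P j ω} ≤ ENNReal.ofReal δ := by
  classical
  let E : ℕ → Ω → ℝ := fun n ω => energy k lam (fun j : Fin n => P j ω) (fun j => y j ω) / 2 -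
        infoGain k lam fun j : Fin n => P j ω
  -- Nothing is known about rounds beyond the horizon; dropping to zero there preserves the
  -- supermartingale property.
  let M : ℕ → Ω → ℝ≥0∞ := fun n ω => if (n : ℕ∞) ≤ N then ENNReal.ofReal (Real.exp (E n ω)) else 0
  let a : ℕ → Ω → ℝ := fun n ω =>
    postMean k lam (fun j : Fin n => P j ω) (fun j : Fin n => y j ω) (P n ω)
  let v : ℕ → Ω → ℝ := fun n ω =>
    1 + postCov k lam (fun j : Fin n => P j ω) (P n ω) (P n ω) / lam
  have hM0 : ∀ ω, M 0 ω = 1 := fun ω => by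
    simp [M, E, energy_zero, infoGain_zero]
  have hMs : ∀ n ω, ((n + 1 : ℕ) : ℕ∞) ≤ N →
      M (n + 1) ω = M n ω * ENNReal.ofReal (gaussianRatio (a n ω) (v n ω) (y n ω)) := by
    intro n ω hn
    have hn' : (n : ℕ∞) ≤ N := (coe_lt_of_succ_le hn).le
    simp only [M, if_pos hn, if_pos hn']
    rw [← ENNReal.ofReal_mul (Real.exp_nonneg _)]
    congr 1
    exact exp_energy_sub_infoGain_succ hk hlam (fun j => P j ω) (fun j => y j ω) n
  have ha : ∀ n : ℕ, (n : ℕ∞) < N → Measurable[ℱ n] (a n) := fun n hn =>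
    measurable_postMean_of_lt hk hP hy hn
  have hv : ∀ n : ℕ, (n : ℕ∞) < N → Measurable[ℱ n] (v n) := fun n hn =>
    ((measurable_postCov_of_lt hk hP hn).div_const _).const_add _
  have hv1 : ∀ n ω, 1 ≤ v n ω := fun n ω => by
    have := div_nonneg (postCov_nonneg hk hlam (fun j : Fin n => P j ω) (P n ω)) hlam.le
    simp only [v]
    linarith
  have hMmeas : ∀ n, Measurable[ℱ n] (M n) := by
    intro n
    induction n with
    | zero => rw [funext hM0]; exact measurable_const
    | succ n ih =>
      by_cases hn : ((n + 1 : ℕ) : ℕ∞) ≤ N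
      · have hlt := coe_lt_of_succ_le hn
        rw [funext fun ω => hMs n ω hn]
        have h1 : Measurable[ℱ (n + 1)] (M n) := ih.mono (ℱ.mono n.le_succ) le_rfl
        have h2 : Measurable[ℱ (n + 1)] (a n) := (ha n hlt).mono (ℱ.mono n.le_succ) le_rfl
        have h3 : Measurable[ℱ (n + 1)] (v n) := (hv n hlt).mono (ℱ.mono n.le_succ) le_rfl
        have h4 := hy n hlt
        unfold gaussianRatio
        fun_prop
      · have : M (n + 1) = fun _ => 0 := funext fun ω => if_neg hn
        rw [this]
        exact measurable_const
  have hsuper : ∀ n A, MeasurableSet[ℱ n] A →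
      ∫⁻ ω in A, M (n + 1) ω ∂μ ≤ ∫⁻ ω in A, M n ω ∂μ := by
    intro n A hA
    by_cases hn : ((n + 1 : ℕ) : ℕ∞) ≤ N
    · have hlt := coe_lt_of_succ_le hn
      have hA' := ℱ.le n A hA
      have hyn : Measurable (y n) := (hy n hlt).mono (ℱ.le _) le_rfl
      rw [← lintegral_indicator hA', ← lintegral_indicator hA']
      refine le_trans (le_of_eq (lintegral_congr fun ω => ?_))
        ((hsub n hlt).gaussianRatio_le (ℱ.le n) hyn (ha n hlt) (hv n hlt) (hv1 n)
          ((hMmeas n).indicator hA))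
      by_cases hω : ω ∈ A
      · simp only [Set.indicator_of_mem hω, hMs n ω hn]
      · simp only [Set.indicator_of_notMem hω, zero_mul]
    · have : M (n + 1) = fun _ => 0 := funext fun ω => if_neg hn
      simp [this]
  have hville := ville_maximal ℱ hMmeas hsuper (ENNReal.ofReal δ⁻¹)
  simp only [hM0, lintegral_const, measure_univ, mul_one] at hville
  have hsubset : {ω | ∃ n : ℕ, (n : ℕ∞) ≤ N ∧ Real.log (1 / δ) ≤ E n ω} ⊆
      {ω | ∃ n, ENNReal.ofReal δ⁻¹ ≤ M n ω} := by
    rintro ω ⟨n, hn, h⟩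
    refine ⟨n, ?_⟩
    simp only [M, if_pos hn]
    refine ENNReal.ofReal_le_ofReal ?_
    rw [← one_div, ← Real.exp_log (show (0 : ℝ) < 1 / δ by positivity)]
    exact Real.exp_le_exp.2 h
  refine (measure_mono hsubset).trans ?_
  have hδ' : ENNReal.ofReal δ ≠ 0 := by simpa using hδ
  rw [ENNReal.ofReal_inv_of_pos hδ] at hville ⊢
  rwa [mul_comm, ← div_eq_mul_inv, ENNReal.div_le_iff_le_mul (Or.inl hδ')
    (Or.inl ENNReal.ofReal_ne_top), one_mul] at hville

end Concentration

/-! ### Information gain and the regret bound -/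

section Regret

open scoped InnerProductSpace

variable {ι H : Type*} [NormedAddCommGroup H] [InnerProductSpace ℝ H]
  {k : ι → ι → ℝ} {φ : ι → H} {lam : ℝ}

lemma infoGain_le_succ (hk : ∀ P Q, k P Q = ⟪φ P, φ Q⟫_ℝ) (hlam : 0 < lam) (P : ℕ → ι) (n : ℕ) :
    infoGain k lam (fun j : Fin n => P j) ≤ infoGain k lam (fun j : Fin (n + 1) => P j) := by
  rw [infoGain_succ hk hlam]
  have hs := postCov_nonneg hk hlam (fun j : Fin n => P j) (P n)
  have := Real.log_nonneg (le_add_of_nonneg_right (div_nonneg hs hlam.le) :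
    1 ≤ 1 + postCov k lam (fun j : Fin n => P j) (P n) (P n) / lam)
  linarith

lemma infoGain_monotone (hk : ∀ P Q, k P Q = ⟪φ P, φ Q⟫_ℝ) (hlam : 0 < lam) (P : ℕ → ι) :
    Monotone fun n => infoGain k lam (fun j : Fin n => P j) :=
  monotone_nat_of_le_succ (infoGain_le_succ hk hlam P)

lemma infoGain_nonneg (hk : ∀ P Q, k P Q = ⟪φ P, φ Q⟫_ℝ) (hlam : 0 < lam) (P : ℕ → ι) (n : ℕ) :
    0 ≤ infoGain k lam (fun j : Fin n => P j) := by
  have h := infoGain_monotone hk hlam P n.zero_le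
  simpa only [infoGain_zero] using h

lemma postCov_div_le_one (hk : ∀ P Q, k P Q = ⟪φ P, φ Q⟫_ℝ) (hk1 : ∀ P, k P P ≤ 1)
    (hlam : 1 ≤ lam) {n : ℕ} (P : Fin n → ι) (Q : ι) : postCov k lam P Q Q / lam ≤ 1 := by
  rw [div_le_one (by linarith)]
  exact ((postCov_le hk (by linarith) P Q).trans (hk1 Q)).trans hlam

lemma infoGain_le (hk : ∀ P Q, k P Q = ⟪φ P, φ Q⟫_ℝ) (hk1 : ∀ P, k P P ≤ 1) (hlam : 1 ≤ lam)
    (P : ℕ → ι) (n : ℕ) :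
    infoGain k lam (fun j : Fin n => P j) ≤ n * (1 / 2 * Real.log 2) := by
  have hlam0 : 0 < lam := by linarith
  induction n with
  | zero => simp [infoGain_zero]
  | succ n ih =>
    rw [infoGain_succ hk hlam0]
    have h0 := div_nonneg (postCov_nonneg hk hlam0 (fun j : Fin n => P j) (P n)) hlam0.le
    have h1 := postCov_div_le_one hk hk1 hlam (fun j : Fin n => P j) (P n)
    have h2 := Real.log_le_log (by linarith :
      0 < 1 + postCov k lam (fun j : Fin n => P j) (P n) (P n) / lam) (by linarith :
      1 + postCov k lam (fun j : Fin n => P j) (P n) (P n) / lam ≤ 2)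
    push_cast
    linarith

/-- A real supremum is meaningful only for bounded families; here each input adds at most `½ log 2`.
-/
lemma bddAbove_infoGain (hk : ∀ P Q, k P Q = ⟪φ P, φ Q⟫_ℝ) (hk1 : ∀ P, k P P ≤ 1)
    (hlam : 1 ≤ lam) (A : Set ι) (n : ℕ) :
    BddAbove (Set.range fun P : Fin n → A => infoGain k lam fun i => (P i : ι)) := by
  refine ⟨n * (1 / 2 * Real.log 2), ?_⟩
  rintro _ ⟨P, rfl⟩
  rcases n with _ | n
  · simp [infoGain_zero]
  -- `infoGain_le` takes an infinite sequence, so the tuple is continued by its first entry; hence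
  -- the separate case of the empty tuple.
  · convert infoGain_le hk hk1 hlam (fun j => if h : j < n + 1 then (P ⟨j, h⟩ : ι) else P 0)
      (n + 1) using 2
    funext j
    rw [dif_pos j.2]

lemma infoGain_le_maxInfoGain (hk : ∀ P Q, k P Q = ⟪φ P, φ Q⟫_ℝ) (hk1 : ∀ P, k P P ≤ 1)
    (hlam : 1 ≤ lam) {A : Set ι} {n : ℕ} (P : Fin n → ι) (hP : ∀ i, P i ∈ A) :
    infoGain k lam P ≤ maxInfoGain k lam A n :=
  le_ciSup (bddAbove_infoGain hk hk1 hlam A n) fun i => ⟨P i, hP i⟩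

/-- Equal inputs give a rank-one perturbation of the identity, whose determinant is `1` plus a
scalar product. -/
lemma infoGain_const (n : ℕ) (Q : ι) :
    infoGain k lam (fun _ : Fin n => Q) = 1 / 2 * Real.log (1 + n * (k Q Q / lam)) := by
  have h : (1 + lam⁻¹ • gram k (fun _ : Fin n => Q)) =
      1 + Matrix.replicateCol Unit (fun _ : Fin n => lam⁻¹) *
        Matrix.replicateRow Unit (fun _ : Fin n => k Q Q) := by
    ext i j
    simp [gram, Matrix.mul_apply]
  rw [infoGain, h, Matrix.det_one_add_replicateCol_mul_replicateRow]
  simp [dotProduct, div_eq_mul_inv]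

lemma half_le_log_one_add {u : ℝ} (h0 : 0 ≤ u) (h1 : u ≤ 1) : u / 2 ≤ Real.log (1 + u) := by
  refine le_trans ?_ (Real.one_sub_inv_le_log_of_pos (by linarith : 0 < 1 + u))
  rw [← sub_nonneg]
  have : 1 - (1 + u)⁻¹ - u / 2 = u * (1 - u) / (2 * (1 + u)) := by field_simp; ring
  rw [this]
  exact div_nonneg (mul_nonneg h0 (by linarith)) (by linarith)

/-- With `u = postCov / lam ≤ 1`, concavity of the logarithm gives `u ≤ 2 log (1 + u)`, which is
four information increments. -/
lemma sum_postCov_le (hk : ∀ P Q, k P Q = ⟪φ P, φ Q⟫_ℝ) (hk1 : ∀ P, k P P ≤ 1) (hlam : 1 ≤ lam)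
    (P : ℕ → ι) (n : ℕ) :
    ∑ i ∈ Finset.range n, postCov k lam (fun j : Fin i => P j) (P i) (P i) ≤
      4 * lam * infoGain k lam fun j : Fin n => P j := by
  have hlam0 : 0 < lam := by linarith
  induction n with
  | zero => simp [infoGain_zero]
  | succ n ih =>
    rw [Finset.sum_range_succ, infoGain_succ hk hlam0]
    have h0 := div_nonneg (postCov_nonneg hk hlam0 (fun j : Fin n => P j) (P n)) hlam0.le
    have h := half_le_log_one_add h0 (postCov_div_le_one hk hk1 hlam (fun j : Fin n => P j) (P n))
    have h2 : postCov k lam (fun j : Fin n => P j) (P n) (P n) = 4 * lam *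
        (postCov k lam (fun j : Fin n => P j) (P n) (P n) / lam / 2 / 2) := by
      field_simp; norm_num
    have h3 : 4 * lam * (postCov k lam (fun j : Fin n => P j) (P n) (P n) / lam / 2 / 2) ≤
        4 * lam * (1 / 2 *
          Real.log (1 + postCov k lam (fun j : Fin n => P j) (P n) (P n) / lam)) := by
      gcongr
      linarith
    linarith

/-- A small maximum information gain forces small prior variances. -/
lemma mul_prior_le (hk : ∀ P Q, k P Q = ⟪φ P, φ Q⟫_ℝ) (hk1 : ∀ P, k P P ≤ 1) (hlam : 1 ≤ lam)
    {A : Set ι} {n : ℕ} (hγ : maxInfoGain k lam A n ≤ 1 / 2) {Q : ι} (hQ : Q ∈ A) :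
    n * k Q Q ≤ 6 * lam * maxInfoGain k lam A n := by
  have hlam0 : 0 < lam := by linarith
  have h := infoGain_le_maxInfoGain hk hk1 hlam (fun _ : Fin n => Q) fun _ => hQ
  rw [infoGain_const] at h
  set γ := maxInfoGain k lam A n
  have hQ0 : 0 ≤ k Q Q := by rw [hk]; exact real_inner_self_nonneg
  obtain ⟨u, hu⟩ : ∃ u : ℝ, u = n * (k Q Q / lam) := ⟨_, rfl⟩
  have hu0 : 0 ≤ u := by rw [hu]; positivity
  rw [← hu] at h
  -- Repeating `Q` gives `log (1 + u) ≤ 2 γ ≤ 1`, so `1 + u ≤ e < 3`; then `u / 3 ≤ log (1 + u) ≤ 2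
  -- γ` produces the constant `6`.
  have h1 : 1 + u ≤ 3 := by
    have : 1 + u ≤ Real.exp 1 := (Real.log_le_iff_le_exp (by linarith)).1 (by linarith)
    linarith [Real.exp_one_lt_d9]
  have h2 := Real.one_sub_inv_le_log_of_pos (by linarith : 0 < 1 + u)
  have h3 : 1 - (1 + u)⁻¹ = u / (1 + u) := by field_simp; ring
  have h4 : u / 3 ≤ u / (1 + u) := by gcongr
  have h5 : n * k Q Q = lam * u := by rw [hu]; field_simp
  rw [h5]
  have h6 : u ≤ 6 * γ := by linarith
  calc lam * u ≤ lam * (6 * γ) := by gcongr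
    _ = 6 * lam * γ := by ring

/-- The confidence bound for the posterior mean. -/
lemma abs_postMean_sub_le (hk : ∀ P Q, k P Q = ⟪φ P, φ Q⟫_ℝ) (hlam : 1 ≤ lam) {f : H} {B : ℝ}
    (hf : ‖f‖ ≤ B) {σ δ : ℝ} (hσ : 0 < σ) {n : ℕ} (P : Fin n → ι) (y : Fin n → ℝ)
    (hgood : energy k lam P (fun j => (y j - ⟪f, φ (P j)⟫_ℝ) / σ) / 2 - infoGain k lam P <
      Real.log (1 / δ)) (Q : ι) :
    |postMean k lam P y Q - ⟪f, φ Q⟫_ℝ| ≤ beta B σ δ (infoGain k lam P) * postStd k lam P Q := by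
  have hlam0 : 0 < lam := by linarith
  set ν : Fin n → ℝ := fun j => (y j - ⟪f, φ (P j)⟫_ℝ) / σ
  have hy : y = fun j => ⟪f, φ (P j)⟫_ℝ + σ * ν j := by
    funext j
    simp only [ν]
    field_simp
    ring
  have h1 := abs_postMean_exact_sub_le hk hlam0 P Q f
  have h2 := abs_postMean_le hk hlam0 P Q ν
  have hE := energy_nonneg hk hlam0 P ν
  have hstd : 0 ≤ postStd k lam P Q := Real.sqrt_nonneg _
  have hsplit : postMean k lam P y Q =
      postMean k lam P (fun j => ⟪f, φ (P j)⟫_ℝ) Q + σ * postMean k lam P ν Q := by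
    conv_lhs => rw [hy]
    rw [postMean_add, postMean_smul]
  have h3 : √(energy k lam P ν / lam) ≤
      √(2 * (infoGain k lam P + 1 + Real.log (1 / δ))) := by
    -- Since `lam ≥ 1` the division can be dropped; the summand `1` in `beta` is slack.
    refine Real.sqrt_le_sqrt ((div_le_self hE hlam).trans ?_)
    linarith
  calc |postMean k lam P y Q - ⟪f, φ Q⟫_ℝ|
      = |(postMean k lam P (fun j => ⟪f, φ (P j)⟫_ℝ) Q - ⟪f, φ Q⟫_ℝ) +
          σ * postMean k lam P ν Q| := by rw [hsplit]; congr 1; ring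
    _ ≤ ‖f‖ * postStd k lam P Q + σ * (√(energy k lam P ν / lam) * postStd k lam P Q) := by
        refine (abs_add_le _ _).trans (add_le_add h1 ?_)
        rw [abs_mul, abs_of_pos hσ]
        gcongr
    _ ≤ B * postStd k lam P Q +
        σ * (√(2 * (infoGain k lam P + 1 + Real.log (1 / δ))) * postStd k lam P Q) := by
        gcongr
    _ = _ := by rw [beta]; ring

/-- The constant of the regret bound. -/
def regretConst (σ Λ : ℝ) : ℝ := 4 * √Λ * (1 + √6 * σ) + 2 * √(6 * Λ) + 1

lemma regretConst_pos {σ : ℝ} (hσ : 0 ≤ σ) (Λ : ℝ) : 0 < regretConst σ Λ := by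
  unfold regretConst
  positivity

/-- The regret of upper confidence bound selection when the noise is well behaved. -/
lemma regret_le (hk : ∀ P Q, k P Q = ⟪φ P, φ Q⟫_ℝ) (hk1 : ∀ P, k P P ≤ 1) {Λ : ℝ}
    (hlam : 1 ≤ lam) (hΛ : lam ≤ Λ) {f : H} {B : ℝ} (hf : ‖f‖ ≤ B) {σ δ : ℝ} (hσ : 0 < σ)
    (hδ : 0 < δ) (hδ1 : δ < 1) {S : Type*} [Nonempty S] (Q : S → ι) (x : ℕ → S) (y : ℕ → ℝ) (n : ℕ)
    (hgood : ∀ i < n, energy k lam (fun j : Fin i => Q (x j))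
      (fun j => (y j - ⟪f, φ (Q (x j))⟫_ℝ) / σ) / 2 - infoGain k lam (fun j : Fin i => Q (x j)) <
      Real.log (1 / δ))
    (hucb : ∀ i < n, ∀ z, postMean k lam (fun j : Fin i => Q (x j)) (fun j => y j) (Q z) +
        beta B σ δ (infoGain k lam fun j : Fin i => Q (x j)) *
          postStd k lam (fun j : Fin i => Q (x j)) (Q z) ≤
      postMean k lam (fun j : Fin i => Q (x j)) (fun j => y j) (Q (x i)) +
        beta B σ δ (infoGain k lam fun j : Fin i => Q (x j)) *
          postStd k lam (fun j : Fin i => Q (x j)) (Q (x i))) :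
    ∑ i ∈ Finset.range n, ((⨆ z, ⟪f, φ (Q z)⟫_ℝ) - ⟪f, φ (Q (x i))⟫_ℝ) ≤
      regretConst σ Λ * (√(n * maxInfoGain k lam (Set.range Q) n) *
        (B + √(maxInfoGain k lam (Set.range Q) n + Real.log (1 / δ)))) := by
  have hlam0 : 0 < lam := by linarith
  have hΛ0 : 0 ≤ Λ := by linarith
  have hB : 0 ≤ B := (norm_nonneg f).trans hf
  have hL : 0 ≤ Real.log (1 / δ) := Real.log_nonneg (by rw [le_div_iff₀ hδ]; linarith)
  have hgain : infoGain k lam (fun j : Fin n => Q (x j)) ≤ maxInfoGain k lam (Set.range Q) n :=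
    infoGain_le_maxInfoGain hk hk1 hlam _ fun i => ⟨_, rfl⟩
  have hγ0 := (infoGain_nonneg hk hlam0 (fun j => Q (x j)) n).trans hgain
  have hsmall := fun h z => mul_prior_le (A := Set.range Q) (n := n) hk hk1 hlam h ⟨z, rfl⟩
  set γ := maxInfoGain k lam (Set.range Q) n
  set L := Real.log (1 / δ)
  set T := √(n * γ) * (B + √(γ + L)) with hT
  have hT0 : 0 ≤ T := by positivity
  -- For `γ ≤ 1/2` every feature has squared norm at most `6 Λ γ / n`, and Cauchy–Schwarz with `‖f‖
  -- ≤ B` suffices. For `γ ≥ 1/2` the confidence bounds are used.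
  rcases le_total γ (1 / 2) with hγ | hγ
  · rcases Nat.eq_zero_or_pos n with rfl | hn
    · simpa using mul_nonneg (regretConst_pos hσ.le Λ).le hT0
    have hn' : (0 : ℝ) < n := by exact_mod_cast hn
    have hφ : ∀ z, ‖φ (Q z)‖ ≤ √(6 * Λ * γ / n) := fun z => by
      refine Real.le_sqrt_of_sq_le ?_
      rw [← real_inner_self_eq_norm_sq, ← hk, le_div_iff₀ hn', mul_comm]
      refine (hsmall hγ z).trans ?_
      gcongr
    have hval : ∀ z, |⟪f, φ (Q z)⟫_ℝ| ≤ B * √(6 * Λ * γ / n) := fun z =>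
      (abs_real_inner_le_norm _ _).trans (by gcongr; exact hφ z)
    have hterm : ∀ i ∈ Finset.range n, (⨆ z, ⟪f, φ (Q z)⟫_ℝ) - ⟪f, φ (Q (x i))⟫_ℝ ≤
        2 * B * √(6 * Λ * γ / n) := fun i _ => by
      have h1 : (⨆ z, ⟪f, φ (Q z)⟫_ℝ) ≤ B * √(6 * Λ * γ / n) :=
        ciSup_le fun z => (le_abs_self _).trans (hval z)
      have h2 := neg_abs_le ⟪f, φ (Q (x i))⟫_ℝ
      have h3 := hval (x i)
      linarith
    refine (Finset.sum_le_sum hterm).trans ?_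
    rw [Finset.sum_const, Finset.card_range, nsmul_eq_mul]
    have h1 : (n : ℝ) * √(6 * Λ * γ / n) = √(6 * Λ) * √(n * γ) := by
      rw [← Real.sqrt_mul (by positivity)]
      rw [show (6 * Λ * (n * γ) : ℝ) = n ^ 2 * (6 * Λ * γ / n) by field_simp,
        Real.sqrt_mul (by positivity), Real.sqrt_sq hn'.le]
    calc (n : ℝ) * (2 * B * √(6 * Λ * γ / n)) = 2 * B * (n * √(6 * Λ * γ / n)) := by ring
      _ = 2 * √(6 * Λ) * (√(n * γ) * B) := by rw [h1]; ring
      _ ≤ 2 * √(6 * Λ) * T := by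
          rw [hT]
          gcongr
          exact le_add_of_nonneg_right (Real.sqrt_nonneg _)
      _ ≤ regretConst σ Λ * T := by
          gcongr
          have : 0 ≤ 4 * √Λ * (1 + √6 * σ) := by positivity
          unfold regretConst
          linarith
  · set b := B + σ * √(2 * (γ + 1 + L)) with hb
    have hb0 : 0 ≤ b := by positivity
    have hterm : ∀ i ∈ Finset.range n, (⨆ z, ⟪f, φ (Q z)⟫_ℝ) - ⟪f, φ (Q (x i))⟫_ℝ ≤
        2 * b * postStd k lam (fun j : Fin i => Q (x j)) (Q (x i)) := fun i hi => by
      have hin := Finset.mem_range.1 hi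
      have hconf := abs_postMean_sub_le hk hlam hf hσ (fun j : Fin i => Q (x j)) (fun j => y j)
        (hgood i hin)
      have hu := hucb i hin
      have hbeta : beta B σ δ (infoGain k lam fun j : Fin i => Q (x j)) ≤ b := by
        have := infoGain_monotone hk hlam0 (fun j => Q (x j)) hin.le
        simp only at this
        rw [beta, hb]
        gcongr
        exact this.trans hgain
      have hstd : 0 ≤ postStd k lam (fun j : Fin i => Q (x j)) (Q (x i)) := Real.sqrt_nonneg _
      set β := beta B σ δ (infoGain k lam fun j : Fin i => Q (x j))
      -- Optimism: the value at any `z` lies below its upper bound, hence below that of the selected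
      -- target, which exceeds its value by at most two widths.
      have h1 : (⨆ z, ⟪f, φ (Q z)⟫_ℝ) ≤ ⟪f, φ (Q (x i))⟫_ℝ +
          2 * (β * postStd k lam (fun j : Fin i => Q (x j)) (Q (x i))) := by
        refine ciSup_le fun z => ?_
        have h2 := (abs_le.1 (hconf (Q z))).1
        have h3 := (abs_le.1 (hconf (Q (x i)))).2
        have h4 := hu z
        linarith
      have h5 := mul_le_mul_of_nonneg_right hbeta hstd
      linarith
    have hcs : ∑ i ∈ Finset.range n, postStd k lam (fun j : Fin i => Q (x j)) (Q (x i)) ≤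
        √(n * (4 * Λ * γ)) := by
      refine Real.le_sqrt_of_sq_le ?_
      refine sq_sum_le_card_mul_sum_sq.trans ?_
      rw [Finset.card_range]
      gcongr
      have h1 := sum_postCov_le hk hk1 hlam (fun j => Q (x j)) n
      have h2 : ∀ i ∈ Finset.range n, postStd k lam (fun j : Fin i => Q (x j)) (Q (x i)) ^ 2 =
          postCov k lam (fun j : Fin i => Q (x j)) (Q (x i)) (Q (x i)) := fun i _ =>
        Real.sq_sqrt (postCov_nonneg hk hlam0 _ _)
      rw [Finset.sum_congr rfl h2]
      have h3 := infoGain_nonneg hk hlam0 (fun j => Q (x j)) n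
      refine h1.trans ?_
      gcongr
    refine (Finset.sum_le_sum hterm).trans ?_
    rw [← Finset.mul_sum]
    have h1 : √(n * (4 * Λ * γ)) = 2 * √Λ * √(n * γ) := by
      rw [show (n : ℝ) * (4 * Λ * γ) = 2 ^ 2 * (Λ * (n * γ)) by ring,
        Real.sqrt_mul (by positivity), Real.sqrt_mul hΛ0, Real.sqrt_sq (by norm_num)]
      ring
    have h2 : b ≤ (1 + √6 * σ) * (B + √(γ + L)) := by
      -- Here `γ ≥ 1/2` is decisive: `1 ≤ 2 γ` gives `γ + 1 + L ≤ 3 (γ + L)`.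
      have : √(2 * (γ + 1 + L)) ≤ √6 * √(γ + L) := by
        rw [← Real.sqrt_mul (by norm_num)]
        refine Real.sqrt_le_sqrt ?_
        linarith
      have h3 : σ * √(2 * (γ + 1 + L)) ≤ σ * (√6 * √(γ + L)) := by gcongr
      have h4 : 0 ≤ √6 * σ * B := by positivity
      have h5 := Real.sqrt_nonneg (γ + L)
      rw [hb]
      linarith
    calc 2 * b * ∑ i ∈ Finset.range n, postStd k lam (fun j : Fin i => Q (x j)) (Q (x i))
        ≤ 2 * ((1 + √6 * σ) * (B + √(γ + L))) * (2 * √Λ * √(n * γ)) := by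
          rw [← h1]
          refine mul_le_mul (by gcongr) hcs
            (Finset.sum_nonneg fun i _ => Real.sqrt_nonneg _) (by positivity)
      _ = 4 * √Λ * (1 + √6 * σ) * T := by rw [hT]; ring
      _ ≤ regretConst σ Λ * T := by
          gcongr
          have : 0 ≤ 2 * √(6 * Λ) := by positivity
          unfold regretConst
          linarith

end Regret

end UGP

end

/-! ### The main theorem -/

theorem mainTheorem1 (σq σζ : ℝ≥0) (hσq : 0 < σq) (Λ : ℝ) :
    ∃ C : ℝ, 0 < C ∧
      ∀ (lam : ℝ), 1 ≤ lam → lam ≤ Λ →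
      -- domain, search space, kernel, RKHS, objective
      ∀ (d : ℕ) (X : Set (EuclideanSpace ℝ (Fin d))) (S : Set X),
        IsCompact S → S.Nonempty →
      ∀ (k : X → X → ℝ), Continuous (fun p : X × X => k p.1 p.2) → (∀ z, k z z ≤ 1) →
      ∀ (H : Type*) [NormedAddCommGroup H] [InnerProductSpace ℝ H] [CompleteSpace H]
        [RKHS ℝ H X ℝ], UGP.IsReproducingKernel H k →
      ∀ (f : H) (B : ℝ), ‖f‖ ≤ B →
      -- query distributions, with sub-Gaussian fluctuations
      ∀ (q : Kernel S X) [IsMarkovKernel q],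
        (∀ z : S, HasSubgaussianMGF (fun u => f u - ∫ v, f v ∂(q z)) (σq ^ 2) (q z)) →
      ∀ (δ : ℝ), 0 < δ → δ < 1 →
      -- a run of the algorithm over `N` rounds
      ∀ (Ω : Type*) [mΩ : MeasurableSpace Ω] (μ : Measure Ω) [IsProbabilityMeasure μ]
        (ℱ : Filtration ℕ mΩ) (N : ℕ∞)
        (x : ℕ → Ω → S) (xq : ℕ → Ω → X) (ζ : ℕ → Ω → ℝ),
        UGP.IsQueryProcess μ ℱ N q f σζ x xq ζ →
        UGP.IsUGPUCB μ N k q lam B (√((σq : ℝ) ^ 2 + (σζ : ℝ) ^ 2)) δ x (UGP.obs f xq ζ) →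
        ENNReal.ofReal (1 - δ) ≤
          μ {ω | ∀ n : ℕ, (n : ℕ∞) ≤ N →
            UGP.cumRegret q f x n ω ≤
              C * (√(n * UGP.maxInfoGain (UGP.distKernel k) lam (Set.range (UGP.queryDist q)) n) *
                (B + √(UGP.maxInfoGain (UGP.distKernel k) lam (Set.range (UGP.queryDist q)) n +
                  Real.log (1 / δ))))} := by
  have hσν : 0 < √((σq : ℝ) ^ 2 + (σζ : ℝ) ^ 2) := by
    have : (0 : ℝ) < σq := by exact_mod_cast hσq
    positivity
  refine ⟨UGP.regretConst √((σq : ℝ) ^ 2 + (σζ : ℝ) ^ 2) Λ, UGP.regretConst_pos hσν.le Λ, ?_⟩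
  intro lam hlam hΛ d X S _ hS k hcont hk1 H _ _ _ _ hker f B hf q _ hq δ hδ hδ1 Ω mΩ μ _ ℱ N x xq ζ
    hproc hucb
  have hlam0 : 0 < lam := by linarith
  have : Nonempty S := hS.to_subtype
  have hk := UGP.distKernel_eq_inner hker hcont hk1
  have hκ1 : ∀ P, UGP.distKernel k P P ≤ 1 := fun P => by
    rw [hk, real_inner_self_eq_norm_sq]
    exact pow_le_one₀ (norm_nonneg _) (UGP.norm_meanEmbed_le hker hk1 P)
  have hfm : Measurable f := UGP.measurable_of_mem_rkhs hker hcont f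
  have hmean : ∀ z : S, ∫ u, f u ∂(q z) =
      inner ℝ f (UGP.meanEmbed H (UGP.queryDist q z)) := fun z =>
    (UGP.inner_meanEmbed hker hcont hk1 f (UGP.queryDist q z)).symm
  have hE : Measurable fun z : S => ∫ u, f u ∂(q z) :=
    (StronglyMeasurable.integral_kernel hfm.stronglyMeasurable).measurable
  set σν := √((σq : ℝ) ^ 2 + (σζ : ℝ) ^ 2)
  let ν : ℕ → Ω → ℝ := fun i ω => (UGP.obs f xq ζ i ω - ∫ u, f u ∂(q (x i ω))) / σν
  have hbad := UGP.measure_energy_ge_le (μ := μ) (ℱ := ℱ) (N := N) (lam := lam)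
    (P := fun i ω => UGP.queryDist q (x i ω)) (y := ν) hk hlam0
    (fun i hi => (UGP.stronglyMeasurable_meanEmbed_queryDist hker hcont q).comp_measurable
      (hproc.target_measurable i hi))
    (fun i hi => ((hproc.obs_measurable i hi).sub (hE.comp
      ((hproc.target_measurable i hi).mono (ℱ.mono i.le_succ) le_rfl))).div_const _)
    (fun i hi => (UGP.subGaussianGiven_obs_sub (ℱ.le i) (hproc.target_measurable i hi)
      (hproc.query_measurable i hi) (hproc.query_law i hi) hfm hq (hproc.noise_measurable i hi)
      (hproc.noise_subGaussian i hi)).div hσν.ne') hδ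
  have hsel : ∀ᵐ ω ∂μ, ∀ i : ℕ, (i : ℕ∞) < N → ∀ z : S,
      UGP.acquisition k q lam B σν δ (fun j : Fin i => x j ω)
          (fun j : Fin i => UGP.obs f xq ζ j ω) z ≤
        UGP.acquisition k q lam B σν δ (fun j : Fin i => x j ω)
          (fun j : Fin i => UGP.obs f xq ζ j ω) (x i ω) :=
    ae_all_iff.2 fun i => Filter.eventually_imp_distrib_left.2 fun hi => hucb i hi
  set bad := {ω | ∃ n : ℕ, (n : ℕ∞) ≤ N ∧ Real.log (1 / δ) ≤
      UGP.energy (UGP.distKernel k) lam (fun j : Fin n => UGP.queryDist q (x j ω))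
        (fun j => ν j ω) / 2 -
      UGP.infoGain (UGP.distKernel k) lam fun j : Fin n => UGP.queryDist q (x j ω)}
  set good := {ω | ∀ n : ℕ, (n : ℕ∞) ≤ N → UGP.cumRegret q f x n ω ≤
    UGP.regretConst σν Λ *
      (√(n * UGP.maxInfoGain (UGP.distKernel k) lam (Set.range (UGP.queryDist q)) n) *
        (B + √(UGP.maxInfoGain (UGP.distKernel k) lam (Set.range (UGP.queryDist q)) n +
          Real.log (1 / δ))))}
  have hsub : ∀ᵐ ω ∂μ, ω ∈ good ∪ bad := by
    filter_upwards [hsel] with ω hω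
    by_cases hb : ω ∈ bad
    · exact Or.inr hb
    refine Or.inl fun n hn => ?_
    have hlt : ∀ i < n, (i : ℕ∞) < N := fun i hi => lt_of_lt_of_le (by exact_mod_cast hi) hn
    have h := UGP.regret_le hk hκ1 hlam hΛ hf hσν hδ hδ1 (UGP.queryDist q) (fun i => x i ω)
      (fun i => UGP.obs f xq ζ i ω) n (fun i hi => ?_) fun i hi => hω i (hlt i hi)
    · simpa only [UGP.cumRegret, hmean] using h
    · simp only [← hmean]
      by_contra hcon
      exact hb ⟨i, (hlt i hi).le, not_lt.1 hcon⟩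
  -- Subadditivity holds for arbitrary sets, so measurability of the regret event need not be
  -- established.
  have hone : 1 ≤ μ good + ENNReal.ofReal δ := by
    calc 1 = μ Set.univ := measure_univ.symm
      _ = μ (good ∪ bad) := (measure_congr (Filter.eventuallyEq_univ.2 hsub)).symm
      _ ≤ μ good + μ bad := measure_union_le _ _
      _ ≤ μ good + ENNReal.ofReal δ := by gcongr
  rw [ENNReal.ofReal_sub _ hδ.le, ENNReal.ofReal_one]
  exact tsub_le_iff_right.2 hone
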